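/- Let $\mathcal P$ be a set of primitive programs (possibly infinite) and $\mathcal B$ a finite nonempty set of primitive tests. A literal is $b$ or $\bar b$ with base $b\in\mathcal B$; $\mathrm{lit}(A)$ is the set of literals with base in $A\subseteq\mathcal B$. A test is a nonempty set of literals with distinct bases. A mixed string is a finite, possibly empty sequence alternating between primitive programs and tests in which every test that is neither first nor last has base $\mathcal B$. The concatenation $\sigma\cdot\tau$ of nonempty mixed strings juxtaposes them if exactly one of the two symbols that meet is a program, and merges the two symbols that meet into their union if they are tests with disjoint bases; it is undefined otherwise, or if the result is not a mixed string; $\epsilon$ is neutral. Mixed expressions are $e::=0\mid 1\mid p\mid l\mid e+e\mid e\cdot e\mid e^*$ ($p\in\mathcal P$, $l\in\mathrm{lit}(\mathcal B)$), with languages $M(0)=\emptyset$, $M(1)=\{\epsilon\}$, $M(p)=\{p\}$, $M(l)=\{\{l\}\}$, $M(e+f)=M(e)\cup M(f)$, $M(e\cdot f)=M(e)\cdot M(f)$, $M(e^*)=\bigcup_{n\ge 0}M(e)^n$. Types $A\to B$ ($A,B\subseteq\mathcal B$) are derived by: $0:A\to B$; $1:A\to A$; $p:\emptyset\to\mathcal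 B$; $l:A\cup\{\mathrm{base}(l)\}\to A\setminus\{\mathrm{base}(l)\}$; $e+f:A\to B$ if $e,f:A\to B$; $e\cdot f:A\to C$ if $e:A\to B$ and $f:B\to C$; $e^*:A\to A$ if $e:A\to A$. Define $\hat T(p)=0$, $\hat T(x)=x$ for $x=0,1,l$, and let $\hat T$ commute with $+,\cdot,{}^*$. Let $\hat\epsilon(e)\in\{0,1\}$ be given by $\hat\epsilon(0)=\hat\epsilon(p)=\hat\epsilon(l)=0$, $\hat\epsilon(1)=\hat\epsilon(e^*)=1$, with $\hat\epsilon(e+f)=0$ iff $\hat\epsilon(e)=\hat\epsilon(f)=0$, and $\hat\epsilon(e\cdot f)=1$ iff $\hat\epsilon(e)=\hat\epsilon(f)=1$. For $x$ a primitive program or a literal, the derivative $\hat D_x$ of an expression with a given type derivation is: $\hat D_x(x)=1$; $\hat D_x(y)=0$ for $y=0$, $y=1$ and for every primitive program or literal $y\ne x$; $\hat D_x(e+f)=\hat D_x(e)+\hat D_x(f)$; $\hat D_x(e^*)=\hat D_x(e)\cdot e^*$; and, for $e:A\to B$ and $f:B\to C$ in the derivation, $\hat D_p(e\cdot f)=\hat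 D_p(e)\cdot f+\hat\epsilon(e)\cdot\hat D_p(f)$ if $B=\emptyset$, $\hat D_l(e\cdot f)=\hat D_l(e)\cdot f+\hat T(e)\cdot\hat D_l(f)$ if $\mathrm{base}(l)\in B$, and $\hat D_x(e\cdot f)=\hat D_x(e)\cdot f$ in the other cases. Let $\equiv$ be the least congruence on mixed expressions that contains associativity, commutativity and idempotence (ACI) of $+$ and the laws $e+0\equiv e$, $0\cdot e\equiv 0$, $e\cdot 0\equiv 0$, $1\cdot e\equiv e$ for the constants. For a relation $R$ on expressions write $e\,R^{\equiv}f$ if $e\equiv e'$, $f\equiv f'$ and $e'\,R\,f'$ for some $e',f'$. A syntactic bisimulation between $e_1,e_2$ of type $B\to\emptyset$ is a family $(R_A)_{A\subseteq\mathcal B}$ of relations on mixed expressions such that: (1) if $e\,R_A\,e'$ then $e,e'$ have type $A\to\emptyset$; (2) $e_1\,R_B\,e_2$; (3) if $e\,R_\emptyset\,e'$ then $\hat\epsilon(e)=\hat\epsilon(e')$ and $\hat D_p(e)\,R_{\mathcal B}^{\equiv}\,\hat D_p(e')$ for all $p\in\mathcal P$; (4) if $e\,R_A\,e'$ with $A\neq\emptyset$,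 then $\hat D_l(e)\,R^{\equiv}_{A\setminus\{\mathrm{base}(l)\}}\,\hat D_l(e')$ for all $l\in\mathrm{lit}(A)$; here (3) and (4) are required for all derivations of the types $A\to\emptyset$ of $e$ and $e'$. It is finite if each $R_A$ has finitely many pairs. **Theorem.** (a) For all mixed expressions $e_1,e_2$ of type $A\to\emptyset$, $M(e_1)=M(e_2)$ if and only if there is a finite syntactic bisimulation between $e_1$ and $e_2$. (b) Equivalence is decidable: if $\mathcal P$ is countable and expressions are coded as natural numbers by means of injective numberings of $\mathcal P$ and $\mathcal B$, there is a computable function that, given the codes of two mixed expressions $e_1,e_2$ of a common type $A\to\emptyset$, decides whether $M(e_1)=M(e_2)$. -/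

import Mathlib

/-!
Mixed strings, mixed languages, mixed expressions and syntactic bisimulations.
Throughout, `P` is the set of primitive programs (possibly infinite) and `B` the finite set of
primitive tests.
-/

namespace KatMixed

/-- A literal over `B`: `(b, true)` is the primitive test `b`, `(b, false)` its negation.
The base of the literal `l` is `l.1`. -/
abbrev Literal (B : Type*) := B × Bool

/-- A symbol of a mixed string: a primitive program, or a finite set of literals. -/
inductive Symb (P B : Type*) where
  | prog (p : P) : Symb P B
  | test (t : Finset (Literal B)) : Symb P B

/-- The symbol is a primitive program. -/
def Symb.IsProg {P B : Type*} : Symb P B → Prop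
  | .prog _ => True
  | .test _ => False

/-- A test is a nonempty set of literals with distinct bases. -/
def IsTest {B : Type*} (t : Finset (Literal B)) : Prop :=
  t.Nonempty ∧ ∀ l ∈ t, ∀ l' ∈ t, l.1 = l'.1 → l = l'

/-- The base of a set of literals. -/
def testBase {B : Type*} [DecidableEq B] (t : Finset (Literal B)) : Finset B :=
  t.image Prod.fst

/-- The conditions for a (possibly empty) sequence of symbols to be a mixed string: every set of
literals in it is a test; programs and tests alternate; every test that is neither the first
nor the last symbol has base `B`. -/
structure IsMixedString {P B : Type*} [Fintype B] [DecidableEq B] (w : List (Symb P B)) :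
    Prop where
  isTest : ∀ t, Symb.test t ∈ w → IsTest t
  alternating : ∀ i a a', w[i]? = some a → w[i + 1]? = some a' → (a.IsProg ↔ ¬ a'.IsProg)
  complete : ∀ i t, 0 < i → i + 1 < w.length → w[i]? = some (Symb.test t) →
    testBase t = Finset.univ

/-- Mixed strings over `P` and `B`. -/
def MixedString (P B : Type*) [Fintype B] [DecidableEq B] :=
  {w : List (Symb P B) // IsMixedString w}

/-- `Joins v w u`: the sequence `u` is the juxtaposition of `v` and `w` at a place where a program
meets a test, or arises by merging the last test of `v` with the first test of `w`, which have
disjoint bases; the empty sequence is neutral. -/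
inductive Joins {P B : Type*} [DecidableEq B] :
    List (Symb P B) → List (Symb P B) → List (Symb P B) → Prop
  | nil_left (w) : Joins [] w w
  | nil_right (v) : Joins v [] v
  | prog_test (v p t w) :
      Joins (v ++ [Symb.prog p]) (Symb.test t :: w) (v ++ Symb.prog p :: Symb.test t :: w)
  | test_prog (v t p w) :
      Joins (v ++ [Symb.test t]) (Symb.prog p :: w) (v ++ Symb.test t :: Symb.prog p :: w)
  | test_test (v s t w) (h : Disjoint (testBase s) (testBase t)) :
      Joins (v ++ [Symb.test s]) (Symb.test t :: w) (v ++ Symb.test (s ∪ t) :: w)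

section Lang

variable {P B : Type*} [Fintype B] [DecidableEq B]

/-- The empty mixed string. -/
def MixedString.nil : MixedString P B :=
  ⟨[], ⟨by simp, by simp, by simp⟩⟩

/-- The mixed string consisting of a single primitive program. -/
def MixedString.ofProg (p : P) : MixedString P B :=
  ⟨[Symb.prog p], ⟨by simp, by simp, by simp⟩⟩

/-- The mixed string consisting of the single test `{l}`. -/
def MixedString.ofLit (l : Literal B) : MixedString P B :=
  ⟨[Symb.test {l}], ⟨by
    intro t ht
    obtain rfl : t = {l} := by simpa using ht
    exact ⟨by simp, fun a ha b hb _ => by simp_all⟩, by simp, by simp⟩⟩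

/-- The concatenation of the mixed strings `σ` and `τ` is defined and equal to `ρ`. (That `ρ` is a
mixed string is part of its type.) -/
def IsConcat (σ τ ρ : MixedString P B) : Prop := Joins σ.1 τ.1 ρ.1

/-- The product `K · L` of two mixed languages. -/
def langMul (K L : Set (MixedString P B)) : Set (MixedString P B) :=
  {ρ | ∃ σ ∈ K, ∃ τ ∈ L, IsConcat σ τ ρ}

/-- The powers of a mixed language. -/
def langPow (L : Set (MixedString P B)) : ℕ → Set (MixedString P B)
  | 0 => {MixedString.nil}
  | n + 1 => langMul L (langPow L n)

end Lang

/-- Mixed expressions. -/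
inductive Expr (P B : Type*) where
  | zero : Expr P B
  | one : Expr P B
  | prog (p : P) : Expr P B
  | lit (l : Literal B) : Expr P B
  | add (e f : Expr P B) : Expr P B
  | mul (e f : Expr P B) : Expr P B
  | star (e : Expr P B) : Expr P B

/-- The mixed language `M(e)` of a mixed expression. -/
def lang {P B : Type*} [Fintype B] [DecidableEq B] : Expr P B → Set (MixedString P B)
  | .zero => ∅
  | .one => {MixedString.nil}
  | .prog p => {MixedString.ofProg p}
  | .lit l => {MixedString.ofLit l}
  | .add e f => lang e ∪ lang f
  | .mul e f => langMul (lang e) (lang f)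
  | .star e => ⋃ n : ℕ, langPow (lang e) n

/-- Derivations of the type judgement `⊢ e : X → Y`, where `X` and `Y` are sets of primitive
tests. -/
inductive TypeDeriv {P B : Type*} [Fintype B] [DecidableEq B] :
    Expr P B → Finset B → Finset B → Type _
  | zero (X Y : Finset B) : TypeDeriv .zero X Y
  | one (X : Finset B) : TypeDeriv .one X X
  | prog (p : P) : TypeDeriv (.prog p) ∅ Finset.univ
  | lit (l : Literal B) (X : Finset B) : TypeDeriv (.lit l) (insert l.1 X) (X.erase l.1)
  | add {e f : Expr P B} {X Y : Finset B} (d : TypeDeriv e X Y) (d' : TypeDeriv f X Y) :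
      TypeDeriv (.add e f) X Y
  | mul {e f : Expr P B} {X Y Z : Finset B} (d : TypeDeriv e X Y) (d' : TypeDeriv f Y Z) :
      TypeDeriv (.mul e f) X Z
  | star {e : Expr P B} {X : Finset B} (d : TypeDeriv e X X) : TypeDeriv (.star e) X X

/-- The type judgement `⊢ e : X → Y`. -/
def HasType {P B : Type*} [Fintype B] [DecidableEq B] (e : Expr P B) (X Y : Finset B) : Prop :=
  Nonempty (TypeDeriv e X Y)

/-- The operator `T̂`. -/
def testHat {P B : Type*} : Expr P B → Expr P B
  | .zero => .zero
  | .one => .one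
  | .prog _ => .zero
  | .lit l => .lit l
  | .add e f => .add (testHat e) (testHat f)
  | .mul e f => .mul (testHat e) (testHat f)
  | .star e => .star (testHat e)

open Classical in
/-- The operator `ε̂`; its value is always the expression `0` or the expression `1`. -/
noncomputable def epsHat {P B : Type*} : Expr P B → Expr P B
  | .zero => .zero
  | .one => .one
  | .prog _ => .zero
  | .lit _ => .zero
  | .add e f => if epsHat e = .zero ∧ epsHat f = .zero then .zero else .one
  | .mul e f => if epsHat e = .one ∧ epsHat f = .one then .one else .zero
  | .star _ => .one

open Classical in
/-- The derivative `D̂_p` with respect to a primitive program. Since it depends on the types of the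
factors of a product, its argument is a type derivation. -/
noncomputable def progDeriv {P B : Type*} [Fintype B] [DecidableEq B] (p : P) :
    {e : Expr P B} → {X Y : Finset B} → TypeDeriv e X Y → Expr P B
  | _, _, _, .zero _ _ => .zero
  | _, _, _, .one _ => .zero
  | _, _, _, .prog q => if p = q then .one else .zero
  | _, _, _, .lit _ _ => .zero
  | _, _, _, .add d d' => .add (progDeriv p d) (progDeriv p d')
  | _, _, _, @TypeDeriv.mul _ _ _ _ e f _ Y _ d d' =>
      if Y = ∅ then .add (.mul (progDeriv p d) f) (.mul (epsHat e) (progDeriv p d'))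
      else .mul (progDeriv p d) f
  | _, _, _, @TypeDeriv.star _ _ _ _ e _ d => .mul (progDeriv p d) (.star e)

/-- The derivative `D̂_l` with respect to a literal. -/
def litDeriv {P B : Type*} [Fintype B] [DecidableEq B] (l : Literal B) :
    {e : Expr P B} → {X Y : Finset B} → TypeDeriv e X Y → Expr P B
  | _, _, _, .zero _ _ => .zero
  | _, _, _, .one _ => .zero
  | _, _, _, .prog _ => .zero
  | _, _, _, .lit l' _ => if l = l' then .one else .zero
  | _, _, _, .add d d' => .add (litDeriv l d) (litDeriv l d')
  | _, _, _, @TypeDeriv.mul _ _ _ _ e f _ Y _ d d' =>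
      if l.1 ∈ Y then .add (.mul (litDeriv l d) f) (.mul (testHat e) (litDeriv l d'))
      else .mul (litDeriv l d) f
  | _, _, _, @TypeDeriv.star _ _ _ _ e _ d => .mul (litDeriv l d) (.star e)

/-- Syntactic equality of mixed expressions up to associativity, commutativity and idempotence
of `+` and the laws `e + 0 = e`, `0 · e = 0`, `e · 0 = 0`, `1 · e = e` for the constants,
applied to arbitrary subexpressions. -/
inductive AciEq {P B : Type*} : Expr P B → Expr P B → Prop
  | assoc (e f g) : AciEq (.add e (.add f g)) (.add (.add e f) g)
  | comm (e f) : AciEq (.add e f) (.add f e)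
  | idem (e) : AciEq (.add e e) e
  | add_zero (e) : AciEq (.add e .zero) e
  | zero_mul (e) : AciEq (.mul .zero e) .zero
  | mul_zero (e) : AciEq (.mul e .zero) .zero
  | one_mul (e) : AciEq (.mul .one e) e
  | refl (e) : AciEq e e
  | symm {e f} (h : AciEq e f) : AciEq f e
  | trans {e f g} (h : AciEq e f) (h' : AciEq f g) : AciEq e g
  | add {e e' f f'} (h : AciEq e e') (h' : AciEq f f') : AciEq (.add e f) (.add e' f')
  | mul {e e' f f'} (h : AciEq e e') (h' : AciEq f f') : AciEq (.mul e f) (.mul e' f')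
  | star {e e'} (h : AciEq e e') : AciEq (.star e) (.star e')

/-- The relation induced by `R` up to `AciEq`. -/
def UpToAci {P B : Type*} (R : Expr P B → Expr P B → Prop) (e₁ e₂ : Expr P B) : Prop :=
  ∃ e₁' e₂', AciEq e₁ e₁' ∧ AciEq e₂ e₂' ∧ R e₁' e₂'

/-- The family `R`, indexed by the sets of primitive tests, is a syntactic bisimulation between the
mixed expressions `e₁` and `e₂` of type `A → ∅`. -/
structure IsSyntacticBisimulation {P B : Type*} [Fintype B] [DecidableEq B]
    (R : Finset B → Expr P B → Expr P B → Prop) (A : Finset B) (e₁ e₂ : Expr P B) : Prop where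
  typed : ∀ X e e', R X e e' → HasType e X ∅ ∧ HasType e' X ∅
  related : R A e₁ e₂
  eps_eq : ∀ e e', R ∅ e e' → epsHat e = epsHat e'
  prog_step : ∀ e e', R ∅ e e' → ∀ (p : P) (d : TypeDeriv e ∅ ∅) (d' : TypeDeriv e' ∅ ∅),
    UpToAci (R Finset.univ) (progDeriv p d) (progDeriv p d')
  lit_step : ∀ X e e', R X e e' → ∀ l : Literal B, l.1 ∈ X →
    ∀ (d : TypeDeriv e X ∅) (d' : TypeDeriv e' X ∅),
      UpToAci (R (X.erase l.1)) (litDeriv l d) (litDeriv l d')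

/-- Each relation of the family has finitely many pairs. -/
def IsFiniteFamily {P B : Type*} (R : Finset B → Expr P B → Expr P B → Prop) : Prop :=
  ∀ X, {q : Expr P B × Expr P B | R X q.1 q.2}.Finite

/-- The Gödel number of a mixed expression, given numberings of the primitive programs and of the
primitive tests; it makes expressions available to algorithms. -/
def code {P B : Type*} (ν : P → ℕ) (β : B → ℕ) : Expr P B → ℕ
  | .zero => 0
  | .one => 1
  | .prog p => 5 * ν p + 2
  | .lit l => 5 * (2 * β l.1 + l.2.toNat) + 3
  | .add e f => 5 * Nat.pair (code ν β e) (code ν β f) + 4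
  | .mul e f => 5 * Nat.pair (code ν β e) (code ν β f) + 5
  | .star e => 5 * code ν β e + 6

end KatMixed

/-! Mixed strings are awkward to compute with, since concatenation is partial and the outer tests
are incomplete. The proof works with guarded strings instead: a first atom `α`, giving a truth value
to every primitive test, followed by a list `u` of programs, each with the atom after it. Products
become fusion products. For `e : X → Y` the language `guarded e` ignores the first atom outside `X`
and leaves the last atom free on `Y` (`IsTyped`), and the elements of `lang e` are its guarded
strings with exactly these values erased (`TypeDeriv.spells`). At target `∅` only irrelevant values
of the first atom are lost, so the two languages determine each other (`lang_eq_iff_guarded_eq`).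

Derivatives are left quotients of guarded languages (`guarded_litDeriv_iff`,
`guarded_progDeriv_iff`), and at source `∅` the operator `epsHat` detects the string without
programs. Hence a bisimulation forces equality: guarded strings are read one literal or one program
at a time. For the converse, pairs with equal languages form a bisimulation, and the point is
finiteness: every typed expression lies in a finite family closed under derivatives up to `AciEq`
(`exists_hasSystem`). The obstacle is the factor `testHat e` that a literal derivative leaves in
front of a product. Such tests are differentiated in turn, but each operation on them removes a
primitive test from the source or yields `0`, so they generate boundedly many others
(`exists_isClosedTests`). The choice of derivation does not matter, because the middle type of a
product is ambiguous only when the left factor is null.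

For decidability, the size of the family is bounded by a primitive recursive function of the code.
Moore's partition refinement then bounds the length of the guarded strings to be compared
(`guarded_eq_of_agree`), and programs with numbers beyond the codes never occur. Finitely many words
remain, and membership of a word is computed bottom-up as a relation between its positions
(`represents_evalRel`). -/

namespace KatMixed

/-! ### Null expressions and the syntactic congruence -/

section Expressions

variable {P B : Type*}

/-- The expression is equal to `0` by the laws for the constants alone. -/
def IsNull : Expr P B → Prop
  | .zero => True
  | .one => False
  | .prog _ => False
  | .lit _ => False
  | .add e f => IsNull e ∧ IsNull f
  | .mul e f => IsNull e ∨ IsNull f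
  | .star _ => False

theorem AciEq.zero_add (e : Expr P B) : AciEq (.add .zero e) e :=
  (AciEq.comm _ _).trans (.add_zero e)

theorem AciEq.mul_zero_left {e : Expr P B} (h : AciEq e .zero) (f : Expr P B) :
    AciEq (.mul e f) .zero :=
  (AciEq.mul h (.refl f)).trans (.zero_mul f)

theorem AciEq.mul_zero_right {f : Expr P B} (h : AciEq f .zero) (e : Expr P B) :
    AciEq (.mul e f) .zero :=
  (AciEq.mul (.refl e) h).trans (.mul_zero e)

theorem AciEq.add_zero_right {e e' f : Expr P B} (h : AciEq e e') (hf : AciEq f .zero) :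
    AciEq (.add e f) e' :=
  (AciEq.add h hf).trans (.add_zero e')

theorem IsNull.aciEq_zero : ∀ {e : Expr P B}, IsNull e → AciEq e .zero
  | .zero, _ => .refl _
  | .add _ _, h => AciEq.add_zero_right h.1.aciEq_zero h.2.aciEq_zero
  | .mul _ f, .inl h => AciEq.mul_zero_left h.aciEq_zero f
  | .mul e _, .inr h => AciEq.mul_zero_right h.aciEq_zero e

theorem epsHat_eq_zero_or_one (e : Expr P B) : epsHat e = .zero ∨ epsHat e = .one := by
  cases e <;> simp only [epsHat] <;> (try split_ifs) <;> simp

theorem epsHat_zero_or_mul {e : Expr P B} (f : Expr P B) :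
    (epsHat e = .zero ∧ AciEq (.mul (epsHat e) f) .zero) ∨
      (epsHat e = .one ∧ AciEq (.mul (epsHat e) f) f) := by
  rcases epsHat_eq_zero_or_one e with h | h
  · exact .inl ⟨h, by rw [h]; exact .zero_mul f⟩
  · exact .inr ⟨h, by rw [h]; exact .one_mul f⟩

theorem IsNull.epsHat : ∀ {e : Expr P B}, IsNull e → epsHat e = .zero
  | .zero, _ => rfl
  | .add _ _, h => by simp [KatMixed.epsHat, h.1.epsHat, h.2.epsHat]
  | .mul _ _, .inl h => by simp [KatMixed.epsHat, h.epsHat]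
  | .mul _ _, .inr h => by simp [KatMixed.epsHat, h.epsHat]

theorem IsNull.testHat : ∀ {e : Expr P B}, IsNull e → IsNull (testHat e)
  | .zero, _ => trivial
  | .add _ _, h => ⟨h.1.testHat, h.2.testHat⟩
  | .mul _ _, .inl h => .inl h.testHat
  | .mul _ _, .inr h => .inr h.testHat

theorem AciEq.testHat {e f : Expr P B} (h : AciEq e f) : AciEq (testHat e) (testHat f) := by
  induction h with
  | assoc => exact .assoc _ _ _
  | comm => exact .comm _ _
  | idem => exact .idem _
  | add_zero => exact .add_zero _
  | zero_mul => exact .zero_mul _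
  | mul_zero => exact .mul_zero _
  | one_mul => exact .one_mul _
  | refl => exact .refl _
  | symm _ ih => exact ih.symm
  | trans _ _ ih ih' => exact ih.trans ih'
  | add _ _ ih ih' => exact .add ih ih'
  | mul _ _ ih ih' => exact .mul ih ih'
  | star _ ih => exact .star ih

end Expressions

/-! ### Independence of the type derivation; types of tests -/

section Types

variable {P B : Type*} [Fintype B] [DecidableEq B]

/-- Null expressions are the only ones whose target is not determined by the source. Their
derivatives stay null whichever clause of the product rule applies, which makes the ambiguity
harmless. -/
theorem IsNull.litDeriv {e : Expr P B} {X Y : Finset B} (d : TypeDeriv e X Y) (h : IsNull e)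
    (l : Literal B) : IsNull (litDeriv l d) := by
  induction d with
  | zero => trivial
  | one => exact h.elim
  | prog => exact h.elim
  | lit => exact h.elim
  | star => exact h.elim
  | add d d' ih ih' => exact ⟨ih h.1, ih' h.2⟩
  | mul d d' ih ih' =>
    simp only [KatMixed.litDeriv]
    rcases h with h | h
    · split_ifs
      · exact ⟨.inl (ih h), .inl h.testHat⟩
      · exact .inl (ih h)
    · split_ifs
      · exact ⟨.inr h, .inr (ih' h)⟩
      · exact .inr h

theorem IsNull.progDeriv {e : Expr P B} {X Y : Finset B} (d : TypeDeriv e X Y) (h : IsNull e)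
    (p : P) : IsNull (progDeriv p d) := by
  induction d with
  | zero => trivial
  | one => exact h.elim
  | prog => exact h.elim
  | lit => exact h.elim
  | star => exact h.elim
  | add d d' ih ih' => exact ⟨ih h.1, ih' h.2⟩
  | mul d d' ih ih' =>
    simp only [KatMixed.progDeriv]
    rcases h with h | h
    · split_ifs
      · exact ⟨.inl (ih h), .inl (by rw [h.epsHat]; trivial)⟩
      · exact .inl (ih h)
    · split_ifs
      · exact ⟨.inr h, .inr (ih' h)⟩
      · exact .inr h

/-- The target of a type derivation is determined by the source, except for null expressions. -/
theorem TypeDeriv.target_unique {e : Expr P B} {X Y : Finset B} (d : TypeDeriv e X Y) :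
    ∀ {X' Y' : Finset B}, TypeDeriv e X' Y' → X = X' → Y = Y' ∨ IsNull e := by
  induction d with
  | zero => exact fun _ _ => .inr trivial
  | one => rintro _ _ ⟨⟩ h; exact .inl h
  | prog => rintro _ _ ⟨⟩ h; exact .inl rfl
  | lit l X =>
    rintro _ _ ⟨⟩ h
    refine .inl ?_
    have := congrArg (fun s => s.erase l.1) h
    simpa using this
  | star => rintro _ _ ⟨⟩ h; exact .inl h
  | add d d' ih ih' =>
    rintro _ _ ⟨⟩ h
    rename_i d₂ d₂'
    rcases ih d₂ h with h1 | h1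
    · exact .inl h1
    · rcases ih' d₂' h with h2 | h2
      · exact .inl h2
      · exact .inr ⟨h1, h2⟩
  | mul d d' ih ih' =>
    rintro _ _ ⟨⟩ h
    rename_i d₂ d₂'
    rcases ih d₂ h with h1 | h1
    · exact (ih' d₂' h1).imp_right .inr
    · exact .inr (.inl h1)

/-- The derivative consults the derivation only through the middle type of a product. By
`TypeDeriv.target_unique` that type is forced by the source, unless the left factor is null; in that
case both derivatives are congruent to `0`. -/
theorem litDeriv_unique (l : Literal B) {e : Expr P B} {X Y : Finset B} (d : TypeDeriv e X Y) :
    ∀ {X' Y' : Finset B} (d' : TypeDeriv e X' Y'), X = X' →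
      AciEq (litDeriv l d) (litDeriv l d') := by
  induction d with
  | zero => rintro _ _ ⟨⟩ h; exact .refl _
  | one => rintro _ _ ⟨⟩ h; exact .refl _
  | prog => rintro _ _ ⟨⟩ h; exact .refl _
  | lit => rintro _ _ ⟨⟩ h; exact .refl _
  | star d ih =>
    rintro _ _ ⟨⟩ h
    exact .mul (ih _ h) (.refl _)
  | add d d' ih ih' =>
    rintro _ _ ⟨⟩ h
    exact .add (ih _ h) (ih' _ h)
  | @mul e f X Y Z d d' ih ih' =>
    intro X' Z' d₃ h
    rcases d₃ with _ | _ | _ | _ | _ | ⟨d₂, d₂'⟩ | _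
    rename_i Y'
    rcases d.target_unique d₂ h with h1 | h1
    · subst h1
      simp only [litDeriv]
      split_ifs
      · exact .add (.mul (ih _ h) (.refl _)) (.mul (.refl _) (ih' _ rfl))
      · exact .mul (ih _ h) (.refl _)
    · exact (IsNull.litDeriv (d.mul d') (.inl h1) l).aciEq_zero.trans
        (IsNull.litDeriv (d₂.mul d₂') (.inl h1) l).aciEq_zero.symm

theorem progDeriv_unique (p : P) {e : Expr P B} {X Y : Finset B} (d : TypeDeriv e X Y) :
    ∀ {X' Y' : Finset B} (d' : TypeDeriv e X' Y'), X = X' →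
      AciEq (progDeriv p d) (progDeriv p d') := by
  induction d with
  | zero => rintro _ _ ⟨⟩ h; exact .refl _
  | one => rintro _ _ ⟨⟩ h; exact .refl _
  | prog => rintro _ _ ⟨⟩ h; exact .refl _
  | lit => rintro _ _ ⟨⟩ h; exact .refl _
  | star d ih =>
    rintro _ _ ⟨⟩ h
    exact .mul (ih _ h) (.refl _)
  | add d d' ih ih' =>
    rintro _ _ ⟨⟩ h
    exact .add (ih _ h) (ih' _ h)
  | @mul e f X Y Z d d' ih ih' =>
    intro X' Z' d₃ h
    rcases d₃ with _ | _ | _ | _ | _ | ⟨d₂, d₂'⟩ | _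
    rename_i Y'
    rcases d.target_unique d₂ h with h1 | h1
    · subst h1
      simp only [progDeriv]
      split_ifs
      · exact .add (.mul (ih _ h) (.refl _)) (.mul (.refl _) (ih' _ rfl))
      · exact .mul (ih _ h) (.refl _)
    · exact (IsNull.progDeriv (d.mul d') (.inl h1) p).aciEq_zero.trans
        (IsNull.progDeriv (d₂.mul d₂') (.inl h1) p).aciEq_zero.symm

/-- Without programs, primitive tests can only be removed. -/
theorem TypeDeriv.isNull_testHat {e : Expr P B} {X Y : Finset B} (d : TypeDeriv e X Y) {b : B}
    (hY : b ∈ Y) (hX : b ∉ X) : IsNull (testHat e) := by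
  induction d with
  | zero => trivial
  | one => exact (hX hY).elim
  | prog => trivial
  | lit l X => exact (hX (Finset.mem_insert_of_mem (Finset.mem_of_mem_erase hY))).elim
  | star => exact (hX hY).elim
  | add d d' ih ih' => exact ⟨ih hY hX, ih' hY hX⟩
  | @mul e f X Z Y d d' ih ih' =>
    by_cases h : b ∈ Z
    · exact .inl (ih h hX)
    · exact .inr (ih' hY h)

/-- A test is not affected by adding a primitive test that remains to be tested. -/
theorem TypeDeriv.exists_testHat_erase {e : Expr P B} {X Y : Finset B} (d : TypeDeriv e X Y)
    {b : B} (hY : b ∈ Y) :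
    ∃ t, testHat t = t ∧ AciEq (testHat e) t ∧ HasType t (X.erase b) (Y.erase b) := by
  induction d with
  | zero => exact ⟨.zero, rfl, .refl _, ⟨.zero _ _⟩⟩
  | one => exact ⟨.one, rfl, .refl _, ⟨.one _⟩⟩
  | prog => exact ⟨.zero, rfl, .refl _, ⟨.zero _ _⟩⟩
  | lit l X =>
    have hb : b ≠ l.1 := Finset.ne_of_mem_erase hY
    refine ⟨.lit l, rfl, .refl _, ?_⟩
    rw [Finset.erase_insert_of_ne hb.symm, Finset.erase_right_comm]
    exact ⟨.lit l _⟩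
  | star d ih =>
    obtain ⟨t, h1, h2, ⟨h3⟩⟩ := ih hY
    exact ⟨.star t, by rw [testHat, h1], .star h2, ⟨.star h3⟩⟩
  | add d d' ih ih' =>
    obtain ⟨t, h1, h2, ⟨h3⟩⟩ := ih hY
    obtain ⟨t', h1', h2', ⟨h3'⟩⟩ := ih' hY
    exact ⟨.add t t', by rw [testHat, h1, h1'], .add h2 h2', ⟨.add h3 h3'⟩⟩
  | @mul e f X Z Y d d' ih ih' =>
    by_cases h : b ∈ Z
    · obtain ⟨t, h1, h2, ⟨h3⟩⟩ := ih h
      obtain ⟨t', h1', h2', ⟨h3'⟩⟩ := ih' hY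
      exact ⟨.mul t t', by rw [testHat, h1, h1'], .mul h2 h2', ⟨.mul h3 h3'⟩⟩
    -- The second factor would have to introduce `b` without a program, so its test part is null and
    -- `0` represents the product.
    · exact ⟨.zero, rfl, (IsNull.aciEq_zero (e := testHat (.mul e f))
        (.inr (d'.isNull_testHat hY h))), ⟨.zero _ _⟩⟩

theorem progDeriv_aciEq_zero_of_testHat {e : Expr P B} {X Y : Finset B} (d : TypeDeriv e X Y)
    (he : testHat e = e) (p : P) : AciEq (progDeriv p d) .zero := by
  induction d with
  | zero => exact .refl _
  | one => exact .refl _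
  | prog => simp [testHat] at he
  | lit l X => exact .refl _
  | star d ih =>
    simp only [testHat, Expr.star.injEq] at he
    exact AciEq.mul_zero_left (ih he) _
  | add d d' ih ih' =>
    simp only [testHat, Expr.add.injEq] at he
    exact AciEq.add_zero_right (ih he.1) (ih' he.2)
  | @mul e f X Z Y d d' ih ih' =>
    simp only [testHat, Expr.mul.injEq] at he
    simp only [progDeriv]
    split_ifs
    · exact AciEq.add_zero_right (AciEq.mul_zero_left (ih he.1) _)
        (AciEq.mul_zero_right (ih' he.2) _)
    · exact AciEq.mul_zero_left (ih he.1) _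

/-- The derivatives of a test have a representative of the expected type. -/
theorem TypeDeriv.exists_litDeriv_of_testHat {e : Expr P B} {X Y : Finset B}
    (d : TypeDeriv e X Y) (he : testHat e = e) (l : Literal B) (hl : l.1 ∈ X) :
    ∃ t, testHat t = t ∧ AciEq (litDeriv l d) t ∧ HasType t (X.erase l.1) Y := by
  induction d with
  | zero => exact ⟨.zero, rfl, .refl _, ⟨.zero _ _⟩⟩
  | one => exact ⟨.zero, rfl, .refl _, ⟨.zero _ _⟩⟩
  | prog => exact ⟨.zero, rfl, by simp at hl, ⟨.zero _ _⟩⟩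
  | lit l' X =>
    by_cases h : l = l'
    · subst h
      refine ⟨.one, rfl, by simp only [litDeriv, if_true]; exact .refl _, ?_⟩
      rw [Finset.erase_insert_eq_erase]
      exact ⟨.one _⟩
    · exact ⟨.zero, rfl, by simp only [litDeriv, if_neg h]; exact .refl _, ⟨.zero _ _⟩⟩
  | star d ih =>
    simp only [testHat, Expr.star.injEq] at he
    obtain ⟨t, h1, h2, ⟨h3⟩⟩ := ih he hl
    exact ⟨.mul t _, by rw [testHat, testHat, h1, he], .mul h2 (.refl _), ⟨.mul h3 (.star d)⟩⟩
  | add d d' ih ih' =>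
    simp only [testHat, Expr.add.injEq] at he
    obtain ⟨t, h1, h2, ⟨h3⟩⟩ := ih he.1 hl
    obtain ⟨t', h1', h2', ⟨h3'⟩⟩ := ih' he.2 hl
    exact ⟨.add t t', by rw [testHat, h1, h1'], .add h2 h2', ⟨.add h3 h3'⟩⟩
  | @mul e f X Z Y d d' ih ih' =>
    simp only [testHat, Expr.mul.injEq] at he
    obtain ⟨t, h1, h2, ⟨h3⟩⟩ := ih he.1 hl
    by_cases h : l.1 ∈ Z
    · obtain ⟨t', h1', h2', ⟨h3'⟩⟩ := ih' he.2 h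
      -- The derivative `t'` of `f` starts at `Z.erase l.1`, so the test in front of it has to end
      -- there; `s` is the representative of `testHat e` with that type.
      obtain ⟨s, g1, g2, ⟨g3⟩⟩ := d.exists_testHat_erase h
      refine ⟨.add (.mul t f) (.mul s t'), by simp only [testHat, h1, h1', he.2, g1], ?_,
        ⟨.add (.mul h3 d') (.mul g3 h3')⟩⟩
      simp only [litDeriv, if_pos h]
      exact .add (.mul h2 (.refl _)) (.mul g2 h2')
    · refine ⟨.mul t f, by rw [testHat, h1, he.2], ?_, ⟨.mul h3 d'⟩⟩
      simp only [litDeriv, if_neg h]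
      exact .mul h2 (.refl _)

end Types

/-! ### Guarded strings -/

section Guarded

variable {P B : Type*}

/-- The last atom of the guarded string with first atom `α` and steps `u`. -/
def lastAtom (α : B → Bool) (u : List (P × (B → Bool))) : B → Bool :=
  u.foldl (fun _ x => x.2) α

@[simp] theorem lastAtom_nil (α : B → Bool) : lastAtom α ([] : List (P × (B → Bool))) = α := rfl

@[simp] theorem lastAtom_cons (α : B → Bool) (x : P × (B → Bool)) (u) :
    lastAtom α (x :: u) = lastAtom x.2 u := rfl

theorem lastAtom_append (α : B → Bool) (u v : List (P × (B → Bool))) :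
    lastAtom α (u ++ v) = lastAtom (lastAtom α u) v := List.foldl_append

/-- The fusion product of two languages of guarded strings. -/
def fusion (G H : (B → Bool) → List (P × (B → Bool)) → Prop) (α : B → Bool)
    (u : List (P × (B → Bool))) : Prop :=
  ∃ u₁ u₂, u = u₁ ++ u₂ ∧ G α u₁ ∧ H (lastAtom α u₁) u₂

/-- The powers of a language of guarded strings. -/
def fusionPow (G : (B → Bool) → List (P × (B → Bool)) → Prop) :
    ℕ → (B → Bool) → List (P × (B → Bool)) → Prop
  | 0 => fun _ u => u = []
  | n + 1 => fusion G (fusionPow G n)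

/-- The language of guarded strings of an expression. -/
def guarded : Expr P B → (B → Bool) → List (P × (B → Bool)) → Prop
  | .zero => fun _ _ => False
  | .one => fun _ u => u = []
  | .prog p => fun _ u => ∃ α', u = [(p, α')]
  | .lit l => fun α u => u = [] ∧ α l.1 = l.2
  | .add e f => fun α u => guarded e α u ∨ guarded f α u
  | .mul e f => fusion (guarded e) (guarded f)
  | .star e => fun α u => ∃ n, fusionPow (guarded e) n α u

theorem fusion_iff_of_left_nil {G H : (B → Bool) → List (P × (B → Bool)) → Prop}
    (hG : ∀ α u, G α u ↔ u = []) : fusion G H = H := by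
  funext α u
  refine propext ⟨?_, fun h => ⟨[], u, rfl, (hG _ _).2 rfl, h⟩⟩
  rintro ⟨u₁, u₂, rfl, h, h'⟩
  rw [hG] at h
  subst h
  exact h'

theorem AciEq.guarded_eq {e f : Expr P B} (h : AciEq e f) : guarded e = guarded f := by
  induction h with
  | assoc => funext α u; simp only [guarded, or_assoc]
  | comm => funext α u; simp only [guarded, or_comm]
  | idem => funext α u; simp only [guarded, or_self]
  | add_zero => funext α u; simp only [guarded, or_false]
  | zero_mul => funext α u; simp [guarded, fusion]
  | mul_zero => funext α u; simp [guarded, fusion]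
  | one_mul => exact fusion_iff_of_left_nil fun _ _ => Iff.rfl
  | refl => rfl
  | symm _ ih => exact ih.symm
  | trans _ _ ih ih' => exact ih.trans ih'
  | add _ _ ih ih' => simp only [guarded, ih, ih']
  | mul _ _ ih ih' => simp only [guarded, ih, ih']
  | star _ ih => simp only [guarded, ih]

theorem guarded_testHat (e : Expr P B) (α : B → Bool) (u : List (P × (B → Bool))) :
    guarded (testHat e) α u ↔ guarded e α u ∧ u = [] := by
  induction e generalizing u with
  | zero => simp [guarded, testHat]
  | one => simp [guarded, testHat]
  | prog p => simp +contextual [guarded, testHat]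
  | lit l => simp +contextual [guarded, testHat]
  | add e f ih ih' => simp only [guarded, testHat, ih, ih', or_and_right]
  | mul e f ih ih' =>
    constructor
    · rintro ⟨u₁, u₂, rfl, h, h'⟩
      obtain ⟨h, rfl⟩ := (ih _).1 h
      obtain ⟨h', rfl⟩ := (ih' _).1 h'
      exact ⟨⟨[], [], rfl, h, h'⟩, rfl⟩
    · rintro ⟨⟨u₁, u₂, hu, h, h'⟩, rfl⟩
      obtain ⟨rfl, rfl⟩ := List.nil_eq_append_iff.1 hu
      exact ⟨[], [], rfl, (ih _).2 ⟨h, rfl⟩, (ih' _).2 ⟨h', rfl⟩⟩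
  | star e ih =>
    constructor
    · rintro ⟨n, h⟩
      suffices u = [] by subst this; exact ⟨⟨0, rfl⟩, rfl⟩
      induction n generalizing u with
      | zero => exact h
      | succ n ihn =>
        obtain ⟨u₁, u₂, rfl, h, h'⟩ := h
        obtain ⟨-, rfl⟩ := (ih _).1 h
        exact ihn _ h'
    · rintro ⟨-, rfl⟩
      exact ⟨0, rfl⟩

theorem guarded_nil_of_epsHat {e : Expr P B} (h : epsHat e = .one) (α : B → Bool) :
    guarded e α [] := by
  induction e with
  | zero => simp [epsHat] at h
  | one => rfl
  | prog p => simp [epsHat] at h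
  | lit l => simp [epsHat] at h
  | add e f ih ih' =>
    rcases epsHat_eq_zero_or_one e with he | he
    · rcases epsHat_eq_zero_or_one f with hf | hf
      · simp [epsHat, he, hf] at h
      · exact .inr (ih' hf)
    · exact .inl (ih he)
  | mul e f ih ih' =>
    have : epsHat e = .one ∧ epsHat f = .one := by
      by_contra hc
      simp [epsHat, hc] at h
    exact ⟨[], [], rfl, ih this.1, ih' this.2⟩
  | star e ih => exact ⟨0, rfl⟩

theorem guarded_epsHat (e : Expr P B) (α : B → Bool) (u : List (P × (B → Bool))) :
    guarded (epsHat e) α u ↔ epsHat e = .one ∧ u = [] := by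
  rcases epsHat_eq_zero_or_one e with h | h <;> simp [h, guarded]

/-- Replacement of the last atom of a guarded string. -/
def setLast (γ : B → Bool) : (B → Bool) → List (P × (B → Bool)) → (B → Bool) × List (P × (B → Bool))
  | _, [] => (γ, [])
  | α, [(p, _)] => (α, [(p, γ)])
  | α, x :: y :: u => (α, x :: (setLast γ x.2 (y :: u)).2)

/-- The properties of the guarded languages of expressions of type `X → Y`. -/
structure IsTyped (X Y : Finset B) (G : (B → Bool) → List (P × (B → Bool)) → Prop) : Prop where
  subset : ∀ α, G α [] → Y ⊆ X
  congr_first : ∀ α α' u, (∀ b ∈ X, α b = α' b) → G α u → G α' u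
  congr_last : ∀ α u γ, (∀ b ∉ Y, γ b = lastAtom α u b) → G α u →
    G (setLast γ α u).1 (setLast γ α u).2

@[simp] theorem setLast_nil (γ α : B → Bool) :
    setLast γ α ([] : List (P × (B → Bool))) = (γ, []) := rfl

theorem setLast_fst (γ α : B → Bool) (u : List (P × (B → Bool))) (hu : u ≠ []) :
    (setLast γ α u).1 = α := by
  rcases u with _ | ⟨x, _ | ⟨y, u⟩⟩
  · exact absurd rfl hu
  · rfl
  · rfl

theorem setLast_cons (γ α : B → Bool) (x : P × (B → Bool)) (u : List (P × (B → Bool))) :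
    setLast γ α (x :: u) = (α, (x.1, (setLast γ x.2 u).1) :: (setLast γ x.2 u).2) := by
  rcases u with _ | ⟨y, u⟩
  · rfl
  · rw [setLast_fst γ x.2 _ (by simp)]
    rfl

theorem setLast_append (γ α : B → Bool) (u v : List (P × (B → Bool))) (hv : v ≠ []) :
    setLast γ α (u ++ v) = (α, u ++ (setLast γ (lastAtom α u) v).2) := by
  induction u generalizing α with
  | nil =>
    refine Prod.ext ?_ rfl
    exact setLast_fst γ α v hv
  | cons x u ih => simp [setLast_cons, ih x.2]

theorem lastAtom_setLast (γ α : B → Bool) (u : List (P × (B → Bool))) :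
    lastAtom (setLast γ α u).1 (setLast γ α u).2 = γ := by
  induction u generalizing α with
  | nil => rfl
  | cons x u ih => simp [setLast_cons, ih]

theorem IsTyped.fusion {X Y Z : Finset B} {G H : (B → Bool) → List (P × (B → Bool)) → Prop}
    (hG : IsTyped X Y G) (hH : IsTyped Y Z H) : IsTyped X Z (fusion G H) where
  subset := by
    rintro α ⟨u₁, u₂, hu, h, h'⟩
    obtain ⟨rfl, rfl⟩ := List.nil_eq_append_iff.1 hu
    exact (hH.subset _ h').trans (hG.subset _ h)
  congr_first := by
    rintro α α' _ hα ⟨u₁, u₂, rfl, h, h'⟩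
    refine ⟨u₁, u₂, rfl, hG.congr_first _ _ _ hα h, ?_⟩
    rcases u₁ with _ | ⟨x, u₁⟩
    · exact hH.congr_first _ _ _ (fun b hb => hα b (hG.subset _ h hb)) h'
    · exact h'
  congr_last := by
    rintro α _ γ hγ ⟨u₁, u₂, rfl, h, h'⟩
    -- If `u₂` is empty, the change also affects the last atom of `u₁`. It is admissible there
    -- because a program-free string in `H` gives `Z ⊆ Y`.
    by_cases h2 : u₂ = []
    · subst h2
      simp only [List.append_nil] at hγ ⊢
      refine ⟨_, [], by simp, hG.congr_last _ _ _ (fun b hb => hγ b fun hb' => hb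
        (hH.subset _ h' hb')) h, ?_⟩
      rw [lastAtom_setLast]
      exact hH.congr_last (lastAtom α u₁) [] γ hγ h'
    · rw [setLast_append _ _ _ _ h2]
      refine ⟨u₁, _, rfl, h, ?_⟩
      have := hH.congr_last (lastAtom α u₁) u₂ γ (by rwa [lastAtom_append] at hγ) h'
      rwa [setLast_fst _ _ _ h2] at this

theorem isTyped_nil (X : Finset B) :
    IsTyped X X (fun _ u => u = [] : (B → Bool) → List (P × (B → Bool)) → Prop) where
  subset _ _ := subset_rfl
  congr_first _ _ _ _ h := h
  congr_last _ _ _ _ h := by subst h; rfl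

theorem IsTyped.fusionPow {X : Finset B} {G : (B → Bool) → List (P × (B → Bool)) → Prop}
    (hG : IsTyped X X G) (n : ℕ) : IsTyped X X (fusionPow G n) := by
  induction n with
  | zero => exact isTyped_nil X
  | succ n ih => exact hG.fusion ih

end Guarded

/-! ### Derivatives are left quotients -/

section Deriv

variable {P B : Type*} [Fintype B] [DecidableEq B]

/-- A guarded string without programs only removes primitive tests. -/
theorem TypeDeriv.subset_of_guarded_nil {e : Expr P B} {X Y : Finset B} (d : TypeDeriv e X Y)
    {α : B → Bool} (h : guarded e α []) : Y ⊆ X := by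
  intro b hY
  by_contra hX
  have h' := (guarded_testHat e α []).2 ⟨h, rfl⟩
  rw [(d.isNull_testHat hY hX).aciEq_zero.guarded_eq] at h'
  exact h'

/-- In general a literal accepts a string without programs although its `epsHat` is `0`. At source
`∅` no literal is typable, and this passes to the right factor of a product, since a program-free
string forces the middle type into the source. -/
theorem TypeDeriv.epsHat_of_guarded_nil {e : Expr P B} {X Y : Finset B} (d : TypeDeriv e X Y)
    (hX : X = ∅) {α : B → Bool} (h : guarded e α []) : epsHat e = .one := by
  induction d with
  | zero => exact h.elim
  | one => rfl
  | prog => simp [guarded] at h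
  | lit => simp at hX
  | star => rfl
  | @add e f _ _ d d' ih ih' =>
    rcases h with h | h
    · simp [epsHat, ih hX h]
    · simp [epsHat, ih' hX h]
  | mul d d' ih ih' =>
    obtain ⟨u₁, u₂, hu, h, h'⟩ := h
    obtain ⟨rfl, rfl⟩ := List.nil_eq_append_iff.1 hu
    have := d.subset_of_guarded_nil h
    simp [epsHat, ih hX h, ih' (by simpa [hX] using this) h']

theorem epsHat_eq_one_iff {e : Expr P B} {Y : Finset B} (d : TypeDeriv e ∅ Y) (α : B → Bool) :
    epsHat e = .one ↔ guarded e α [] :=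
  ⟨fun h => guarded_nil_of_epsHat h α, d.epsHat_of_guarded_nil rfl⟩

theorem guarded_of_litDeriv {e : Expr P B} {X Y : Finset B} (d : TypeDeriv e X Y) (l : Literal B)
    {α : B → Bool} (hα : α l.1 = l.2) {u : List (P × (B → Bool))}
    (h : guarded (litDeriv l d) α u) : guarded e α u := by
  induction d generalizing u with
  | zero => exact h
  | one => exact h.elim
  | prog => exact h.elim
  | lit l' X =>
    simp only [litDeriv] at h
    split_ifs at h with hl
    · exact ⟨h, hl ▸ hα⟩
    · exact h.elim
  | star d ih =>
    obtain ⟨u₁, u₂, rfl, h, n, h'⟩ := h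
    exact ⟨n + 1, u₁, u₂, rfl, ih h, h'⟩
  | add d d' ih ih' => exact h.imp ih ih'
  | @mul e f X Z Y d d' ih ih' =>
    have key : guarded (.mul (litDeriv l d) f) α u → guarded (.mul e f) α u := by
      rintro ⟨u₁, u₂, rfl, h, h'⟩
      exact ⟨u₁, u₂, rfl, ih h, h'⟩
    simp only [litDeriv] at h
    split_ifs at h
    · rcases h with h | ⟨u₁, u₂, rfl, h, h'⟩
      · exact key h
      · obtain ⟨h, rfl⟩ := (guarded_testHat _ _ _).1 h
        exact ⟨[], u₂, rfl, h, ih' h'⟩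
    · exact key h

/-- The hypothesis `hY` says that the base of `l` really gets consumed: either a program occurs or
the base is absent from the target. This form survives induction. If a left factor contributes no
program and keeps the base in the middle type, the obligation moves to the right factor, and the
`testHat` summand of the product rule accounts for it. In a star, program-free iterations are
skipped. -/
theorem guarded_litDeriv {e : Expr P B} {X Y : Finset B} (d : TypeDeriv e X Y) (l : Literal B)
    {α : B → Bool} {u : List (P × (B → Bool))} (hα : α l.1 = l.2) (hX : l.1 ∈ X)
    (hY : u ≠ [] ∨ l.1 ∉ Y) (h : guarded e α u) : guarded (litDeriv l d) α u := by
  induction d generalizing u with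
  | zero => exact h
  | one =>
    have : u = [] := h
    simp_all
  | prog => simp at hX
  | lit l' X =>
    obtain ⟨rfl, h⟩ := h
    have : l = l' := by
      simp only [Finset.mem_insert, Finset.mem_erase] at hX hY
      have h1 : l.1 = l'.1 := by tauto
      exact Prod.ext h1 (by rw [← hα, ← h, h1])
    simp [litDeriv, this, guarded]
  | @star e X d ih =>
    obtain ⟨n, h⟩ := h
    induction n with
    | zero =>
      have : u = [] := h
      simp_all
    | succ n ihn =>
      obtain ⟨u₁, u₂, rfl, h, h'⟩ := h
      by_cases h1 : u₁ = []
      · subst h1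
        exact ihn h'
      · exact ⟨u₁, u₂, rfl, ih hX (.inl h1) h, n, h'⟩
  | add d d' ih ih' => exact h.imp (ih hX hY) (ih' hX hY)
  | @mul e f X Z Y d d' ih ih' =>
    obtain ⟨u₁, u₂, rfl, h, h'⟩ := h
    simp only [litDeriv]
    by_cases h1 : u₁ ≠ [] ∨ l.1 ∉ Z
    · have key : guarded (.mul (litDeriv l d) f) α (u₁ ++ u₂) := ⟨u₁, u₂, rfl, ih hX h1 h, h'⟩
      split_ifs
      · exact .inl key
      · exact key
    · push Not at h1
      obtain ⟨rfl, hZ⟩ := h1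
      rw [if_pos hZ]
      exact .inr ⟨[], u₂, rfl, (guarded_testHat _ _ _).2 ⟨h, rfl⟩, ih' hZ hY h'⟩

theorem guarded_litDeriv_iff {e : Expr P B} {X : Finset B} (d : TypeDeriv e X ∅) (l : Literal B)
    {α : B → Bool} {u : List (P × (B → Bool))} (hα : α l.1 = l.2) (hX : l.1 ∈ X) :
    guarded (litDeriv l d) α u ↔ guarded e α u :=
  ⟨guarded_of_litDeriv d l hα, guarded_litDeriv d l hα hX (by simp)⟩

theorem guarded_of_progDeriv {e : Expr P B} {X Y : Finset B} (d : TypeDeriv e X Y) (p : P)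
    {α α' : B → Bool} {u : List (P × (B → Bool))}
    (h : guarded (progDeriv p d) α' u) : guarded e α ((p, α') :: u) := by
  induction d generalizing u with
  | zero => exact h
  | one => exact h.elim
  | lit => exact h.elim
  | prog q =>
    simp only [progDeriv] at h
    split_ifs at h with hl
    · exact ⟨α', by rw [hl, show u = [] from h]⟩
    · exact h.elim
  | star d ih =>
    obtain ⟨u₁, u₂, rfl, h, n, h'⟩ := h
    exact ⟨n + 1, _ :: u₁, u₂, rfl, ih h, h'⟩
  | add d d' ih ih' => exact h.imp ih ih'
  | @mul e f X Z Y d d' ih ih' =>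
    have key : guarded (.mul (progDeriv p d) f) α' u → guarded (.mul e f) α ((p, α') :: u) := by
      rintro ⟨u₁, u₂, rfl, h, h'⟩
      exact ⟨_ :: u₁, u₂, rfl, ih h, h'⟩
    simp only [progDeriv] at h
    split_ifs at h
    · rcases h with h | ⟨u₁, u₂, rfl, h, h'⟩
      · exact key h
      · obtain ⟨h0, rfl⟩ := (guarded_epsHat _ _ _).1 h
        exact ⟨[], _, rfl, guarded_nil_of_epsHat h0 _, ih' h'⟩
    · exact key h

theorem guarded_progDeriv {e : Expr P B} {X Y : Finset B} (d : TypeDeriv e X Y) (p : P)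
    {α α' : B → Bool} {u : List (P × (B → Bool))} (hX : X = ∅)
    (h : guarded e α ((p, α') :: u)) : guarded (progDeriv p d) α' u := by
  induction d generalizing u with
  | zero => exact h
  | one => simp [guarded] at h
  | lit => simp at hX
  | prog q =>
    obtain ⟨β, h⟩ := h
    simp only [List.cons.injEq, Prod.mk.injEq] at h
    simp [progDeriv, h, guarded]
  | @star e X d ih =>
    obtain ⟨n, h⟩ := h
    induction n with
    | zero => simp [fusionPow] at h
    | succ n ihn =>
      obtain ⟨u₁, u₂, hu, h, h'⟩ := h
      rcases List.cons_eq_append_iff.1 hu with ⟨rfl, rfl⟩ | ⟨v, rfl, rfl⟩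
      · exact ihn h'
      · exact ⟨v, u₂, rfl, ih hX h, n, h'⟩
  | add d d' ih ih' => exact h.imp (ih hX) (ih' hX)
  | @mul e f X Z Y d d' ih ih' =>
    obtain ⟨u₁, u₂, hu, h, h'⟩ := h
    simp only [progDeriv]
    rcases List.cons_eq_append_iff.1 hu with ⟨rfl, rfl⟩ | ⟨v, rfl, rfl⟩
    · have hZ : Z = ∅ := by simpa [hX] using d.subset_of_guarded_nil h
      rw [if_pos hZ]
      exact .inr ⟨[], u, rfl, (guarded_epsHat _ _ _).2 ⟨d.epsHat_of_guarded_nil hX h, rfl⟩,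
        ih' hZ h'⟩
    · have key : guarded (.mul (progDeriv p d) f) α' (v ++ u₂) := ⟨v, u₂, rfl, ih hX h, h'⟩
      split_ifs
      · exact .inl key
      · exact key

theorem guarded_progDeriv_iff {e : Expr P B} {Y : Finset B} (d : TypeDeriv e ∅ Y) (p : P)
    (α : B → Bool) {α' : B → Bool} {u : List (P × (B → Bool))} :
    guarded (progDeriv p d) α' u ↔ guarded e α ((p, α') :: u) :=
  ⟨guarded_of_progDeriv d p, guarded_progDeriv d p rfl⟩

theorem TypeDeriv.isTyped {e : Expr P B} {X Y : Finset B} (d : TypeDeriv e X Y) :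
    IsTyped X Y (guarded e) := by
  induction d with
  | zero => exact ⟨fun _ h => h.elim, fun _ _ _ _ h => h.elim, fun _ _ _ _ h => h.elim⟩
  | one X => exact isTyped_nil X
  | prog p =>
    refine ⟨fun α h => by simp [guarded] at h, fun _ _ _ _ h => h, ?_⟩
    rintro α u γ - ⟨β, rfl⟩
    exact ⟨γ, rfl⟩
  | lit l X =>
    refine ⟨fun _ _ => (Finset.erase_subset _ _).trans (Finset.subset_insert _ _), ?_, ?_⟩
    · rintro α α' u h ⟨rfl, h'⟩
      exact ⟨rfl, by rw [← h _ (Finset.mem_insert_self _ _), h']⟩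
    · rintro α u γ h ⟨rfl, h'⟩
      exact ⟨rfl, by rw [← h']; exact h _ (by simp)⟩
  | add d d' ih ih' =>
    exact ⟨fun α h => h.elim (ih.subset α) (ih'.subset α),
      fun α α' u h => Or.imp (ih.congr_first α α' u h) (ih'.congr_first α α' u h),
      fun α u γ h => Or.imp (ih.congr_last α u γ h) (ih'.congr_last α u γ h)⟩
  | mul d d' ih ih' => exact ih.fusion ih'
  | star d ih =>
    refine ⟨fun _ _ => subset_rfl, ?_, ?_⟩
    · rintro α α' u h ⟨n, h'⟩
      exact ⟨n, (ih.fusionPow n).congr_first α α' u h h'⟩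
    · rintro α u γ h ⟨n, h'⟩
      exact ⟨n, (ih.fusionPow n).congr_last α u γ h h'⟩

end Deriv

/-! ### Spelling guarded strings as mixed strings -/

section Segments

variable {P B : Type*} [DecidableEq B]

/-- The literals with base in `S` that hold at the atom `α`. -/
def restrAtom (α : B → Bool) (S : Finset B) : Finset (Literal B) :=
  S.image fun b => (b, α b)

/-- The sequence consisting of the test `t`, empty if `t` is. -/
def optTest (t : Finset (Literal B)) : List (Symb P B) :=
  if t = ∅ then [] else [Symb.test t]

theorem restrAtom_eq_empty {α : B → Bool} {S : Finset B} : restrAtom α S = ∅ ↔ S = ∅ := by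
  simp [restrAtom]

theorem testBase_restrAtom (α : B → Bool) (S : Finset B) : testBase (restrAtom α S) = S := by
  simp [testBase, restrAtom, Finset.image_image, Function.comp_def]

theorem restrAtom_congr_iff {α β : B → Bool} {S : Finset B} :
    restrAtom α S = restrAtom β S ↔ ∀ b ∈ S, α b = β b := by
  constructor
  · intro h b hb
    have : (b, α b) ∈ restrAtom β S := h ▸ Finset.mem_image_of_mem _ hb
    simp only [restrAtom, Finset.mem_image, Prod.mk.injEq] at this
    obtain ⟨a, -, rfl, h⟩ := this
    exact h.symm
  · intro h
    exact Finset.image_congr fun b hb => by simp [h b hb]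

theorem isTest_restrAtom (α : B → Bool) {S : Finset B} (hS : S ≠ ∅) :
    IsTest (restrAtom α S) := by
  refine ⟨Finset.nonempty_iff_ne_empty.2 (mt restrAtom_eq_empty.1 hS), ?_⟩
  intro l hl l' hl' h
  simp only [restrAtom, Finset.mem_image] at hl hl'
  obtain ⟨b, -, rfl⟩ := hl
  obtain ⟨b', -, rfl⟩ := hl'
  simp only at h
  rw [h]

@[simp] theorem optTest_restrAtom_empty (α : B → Bool) :
    (optTest (restrAtom α ∅) : List (Symb P B)) = [] := by
  simp [optTest, restrAtom]

theorem optTest_restrAtom (α : B → Bool) {S : Finset B} (hS : S ≠ ∅) :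
    (optTest (restrAtom α S) : List (Symb P B)) = [Symb.test (restrAtom α S)] := by
  simp [optTest, restrAtom_eq_empty, hS]

variable [Fintype B]

/-- The symbols of the mixed string of type `X → Y` that spells a guarded string. -/
def segment (Y : Finset B) : Finset B → (B → Bool) → List (P × (B → Bool)) → List (Symb P B)
  | X, α, [] => optTest (restrAtom α (X \ Y))
  | X, α, x :: u => optTest (restrAtom α X) ++ Symb.prog x.1 :: segment Y Finset.univ x.2 u

theorem segment_congr_first {X Y : Finset B} {α β : B → Bool} (h : ∀ b ∈ X, α b = β b)
    (u : List (P × (B → Bool))) : segment Y X α u = segment Y X β u := by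
  rcases u with _ | ⟨x, u⟩
  · rw [segment, segment, restrAtom_congr_iff.2 fun b hb => h b (Finset.mem_sdiff.1 hb).1]
  · rw [segment, segment, restrAtom_congr_iff.2 h]

theorem segment_setLast {X Y : Finset B} {α γ : B → Bool} {u : List (P × (B → Bool))}
    (h : ∀ b ∉ Y, γ b = lastAtom α u b) :
    segment Y X (setLast γ α u).1 (setLast γ α u).2 = segment Y X α u := by
  induction u generalizing X α with
  | nil =>
    rw [setLast_nil, segment, segment,
      restrAtom_congr_iff.2 fun b hb => h b (Finset.mem_sdiff.1 hb).2]
    rfl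
  | cons x u ih =>
    simp only [setLast_cons, segment]
    rw [ih h]

theorem isMixedString_test {t : Finset (Literal B)} (h : IsTest t) :
    IsMixedString [(Symb.test t : Symb P B)] where
  isTest s hs := by
    obtain rfl : s = t := by simpa using hs
    exact h
  alternating := by simp
  complete := by simp

theorem isMixedString_prog_cons (p : P) {w : List (Symb P B)} (h : IsMixedString w)
    (h0 : ∀ a, w[0]? = some a → ¬ a.IsProg)
    (h1 : ∀ t, w[0]? = some (.test t) → 1 < w.length → testBase t = Finset.univ) :
    IsMixedString (Symb.prog p :: w) where
  isTest s hs := h.isTest s (by simpa using hs)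
  alternating i a a' ha ha' := by
    rcases i with _ | i
    · simp only [List.getElem?_cons_zero, Option.some.injEq] at ha
      subst ha
      exact ⟨fun _ => h0 a' (by simpa using ha'), fun _ => trivial⟩
    · exact h.alternating i a a' (by simpa using ha) (by simpa using ha')
  complete i t hi hi' ht := by
    rcases i with _ | i
    · omega
    · simp only [List.length_cons, List.getElem?_cons_succ] at hi' ht
      rcases i with _ | i
      · exact h1 t ht (by omega)
      · exact h.complete (i + 1) t (by omega) (by omega) ht

theorem isMixedString_test_prog_cons {t : Finset (Literal B)} (ht : IsTest t) (p : P)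
    {w : List (Symb P B)} (h : IsMixedString (Symb.prog p :: w)) :
    IsMixedString (Symb.test t :: Symb.prog p :: w) where
  isTest s hs := by
    rcases List.mem_cons.1 hs with hs | hs
    · cases hs
      exact ht
    · exact h.isTest s hs
  alternating i a a' ha ha' := by
    rcases i with _ | i
    · simp only [List.getElem?_cons_zero, zero_add, List.getElem?_cons_succ,
        Option.some.injEq] at ha ha'
      subst ha ha'
      simp [Symb.IsProg]
    · exact h.alternating i a a' (by simpa using ha) (by simpa using ha')
  complete i s hi hi' hs := by
    rcases i with _ | _ | i
    · omega
    · simp at hs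
    · exact h.complete (i + 1) s (by omega) (by simpa using hi') (by simpa using hs)

/-- This is where non-emptiness of `B` enters: between two programs the spelling always places a
test, so that symbols alternate. -/
theorem segment_univ_head [Nonempty B] (Y : Finset B) (α : B → Bool)
    (u : List (P × (B → Bool))) :
    segment Y Finset.univ α u = [] ∨ ∃ t w, segment Y Finset.univ α u = Symb.test t :: w ∧
      (w ≠ [] → testBase t = Finset.univ) := by
  rcases u with _ | ⟨x, u⟩
  · by_cases h : Finset.univ \ Y = ∅
    · exact .inl (by rw [segment, h, optTest_restrAtom_empty])
    · exact .inr ⟨_, [], by rw [segment, optTest_restrAtom _ h], by simp⟩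
  · exact .inr ⟨_, _, by rw [segment, optTest_restrAtom _ Finset.univ_nonempty.ne_empty]; rfl,
      fun _ => testBase_restrAtom _ _⟩

theorem isMixedString_segment [Nonempty B] (X Y : Finset B) (α : B → Bool)
    (u : List (P × (B → Bool))) : IsMixedString (segment Y X α u) := by
  induction u generalizing X α with
  | nil =>
    by_cases h : X \ Y = ∅
    · rw [segment, h, optTest_restrAtom_empty]
      exact ⟨by simp, by simp, by simp⟩
    · rw [segment, optTest_restrAtom _ h]
      exact isMixedString_test (isTest_restrAtom _ h)
  | cons x u ih =>
    have key : IsMixedString (Symb.prog x.1 :: segment Y Finset.univ x.2 u) := by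
      refine isMixedString_prog_cons _ (ih _ _) ?_ ?_
      · intro a ha
        rcases segment_univ_head Y x.2 u with h | ⟨t, w, h, -⟩
        · simp [h] at ha
        · simp only [h, List.getElem?_cons_zero, Option.some.injEq] at ha
          subst ha
          exact id
      · intro s hs hl
        rcases segment_univ_head Y x.2 u with h | ⟨t, w, h, h'⟩
        · simp [h] at hs
        · simp only [h, List.getElem?_cons_zero, Option.some.injEq, Symb.test.injEq] at hs
          subst hs
          refine h' ?_
          rintro rfl
          simp [h] at hl
    by_cases h : X = ∅
    · subst h
      rwa [segment, optTest_restrAtom_empty]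
    · rw [segment, optTest_restrAtom _ h]
      exact isMixedString_test_prog_cons (isTest_restrAtom _ h) _ key

omit [Fintype B] in
theorem Joins.append_left {a b c : List (Symb P B)} (h : Joins a b c) (ha : a ≠ [])
    (v : List (Symb P B)) : Joins (v ++ a) b (v ++ c) := by
  cases h with
  | nil_left => exact absurd rfl ha
  | nil_right => exact .nil_right _
  | prog_test v' p t w => simpa using Joins.prog_test (v ++ v') p t w
  | test_prog v' p t w => simpa using Joins.test_prog (v ++ v') p t w
  | test_test v' p t w h => simpa using Joins.test_test (v ++ v') p t w h

omit [Fintype B] in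
theorem Joins.cases_eq {a b c : List (Symb P B)} (h : Joins a b c) :
    (a = [] ∧ c = b) ∨ (b = [] ∧ c = a) ∨
    (∃ v x y w, a = v ++ [x] ∧ b = y :: w ∧
      ((c = v ++ x :: y :: w ∧ (x.IsProg ↔ ¬ y.IsProg)) ∨
        ∃ s t, x = .test s ∧ y = .test t ∧ c = v ++ Symb.test (s ∪ t) :: w)) := by
  cases h with
  | nil_left => exact .inl ⟨rfl, rfl⟩
  | nil_right => exact .inr (.inl ⟨rfl, rfl⟩)
  | prog_test v p t w =>
    exact .inr (.inr ⟨v, _, _, w, rfl, rfl, .inl ⟨rfl, by simp [Symb.IsProg]⟩⟩)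
  | test_prog v t p w =>
    exact .inr (.inr ⟨v, _, _, w, rfl, rfl, .inl ⟨rfl, by simp [Symb.IsProg]⟩⟩)
  | test_test v s t w h =>
    exact .inr (.inr ⟨v, _, _, w, rfl, rfl, .inr ⟨s, t, rfl, rfl, rfl⟩⟩)

omit [Fintype B] in
theorem Joins.unique {a b c c' : List (Symb P B)} (h : Joins a b c) (h' : Joins a b c') :
    c = c' := by
  rcases h.cases_eq with ⟨ha, hc⟩ | ⟨hb, hc⟩ | ⟨v, x, y, w, ha, hb, hc⟩ <;>
    rcases h'.cases_eq with ⟨ha', hc'⟩ | ⟨hb', hc'⟩ | ⟨v', x', y', w', ha', hb', hc'⟩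
  -- In all combinations except the last one, at least one operand is empty.
  iterate 8 simp_all
  rw [ha] at ha'
  rw [hb] at hb'
  obtain ⟨rfl, h1⟩ := List.append_inj' ha' rfl
  obtain rfl : x = x' := by simpa using h1
  obtain ⟨rfl, rfl⟩ := List.cons.inj hb'
  rcases hc with ⟨hc, hx⟩ | ⟨s, t, rfl, rfl, hc⟩ <;>
    rcases hc' with ⟨hc', hx'⟩ | ⟨s', t', h1, h2, hc'⟩
  · rw [hc, hc']
  · subst h1 h2
    simp [Symb.IsProg] at hx
  · simp [Symb.IsProg] at hx'
  · cases h1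
    cases h2
    rw [hc, hc']

omit [Fintype B] in
theorem restrAtom_union (α : B → Bool) (S T : Finset B) :
    restrAtom α S ∪ restrAtom α T = restrAtom α (S ∪ T) :=
  (Finset.image_union _ _).symm

/-- Where the two spellings meet, the left one has tested only bases outside `Y` and the right one
tests only bases in `Y`. Adjacent tests are therefore disjoint, and as restrictions of the same atom
`lastAtom α u` they merge into the test required by the spelling of the whole. -/
theorem joins_segment [Nonempty B] {X Y Z : Finset B} {α : B → Bool}
    {u v : List (P × (B → Bool))} (hu : u = [] → Y ⊆ X) (hv : v = [] → Z ⊆ Y) :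
    Joins (segment Y X α u) (segment Z Y (lastAtom α u) v) (segment Z X α (u ++ v)) := by
  induction u generalizing X α with
  | nil =>
    have hYX := hu rfl
    simp only [lastAtom_nil, List.nil_append]
    by_cases h : X \ Y = ∅
    · obtain rfl : X = Y := (Finset.sdiff_eq_empty_iff_subset.1 h).antisymm hYX
      rw [segment, h, optTest_restrAtom_empty]
      exact .nil_left _
    · have hdisj : ∀ S ⊆ Y, Disjoint (testBase (restrAtom α (X \ Y))) (testBase (restrAtom α S)) := by
        intro S hS
        rw [testBase_restrAtom, testBase_restrAtom]
        exact Finset.sdiff_disjoint.mono_right hS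
      have hX : X ≠ ∅ := by rintro rfl; simp at h
      rw [segment, optTest_restrAtom _ h]
      rcases v with _ | ⟨x, v⟩
      · have hZY := hv rfl
        have hu' : X \ Y ∪ Y \ Z = X \ Z := by
          ext b
          have := @hZY b
          have := @hYX b
          simp only [Finset.mem_union, Finset.mem_sdiff]
          tauto
        rw [segment, segment]
        by_cases h' : Y \ Z = ∅
        · obtain rfl : Y = Z := (Finset.sdiff_eq_empty_iff_subset.1 h').antisymm hZY
          rw [h', optTest_restrAtom_empty, optTest_restrAtom _ h]
          exact .nil_right _
        · rw [optTest_restrAtom _ h', optTest_restrAtom, ← hu', ← restrAtom_union]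
          · exact .test_test [] _ _ [] (hdisj _ Finset.sdiff_subset)
          · rw [← hu']
            simp [h]
      · rw [segment, segment, optTest_restrAtom _ hX]
        by_cases h' : Y = ∅
        · subst h'
          rw [optTest_restrAtom_empty, Finset.sdiff_empty]
          exact .test_prog [] _ _ _
        · rw [optTest_restrAtom _ h', ← Finset.sdiff_union_of_subset hYX, ← restrAtom_union]
          simp only [Finset.sdiff_union_of_subset hYX]
          exact .test_test [] _ _ _ (hdisj _ subset_rfl)
  | cons x u ih =>
    simp only [lastAtom_cons, List.cons_append, segment]
    -- The remaining left spelling is empty only if no step is left and `Y` is everything. The left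
    -- operand then ends in the program `x.1`, and juxtaposition replaces merging.
    by_cases h : segment Y Finset.univ x.2 u = []
    · have hu : u = [] ∧ Y = Finset.univ := by
        rcases u with _ | ⟨y, u⟩
        · refine ⟨rfl, ?_⟩
          by_contra hY
          have : Finset.univ \ Y ≠ ∅ := by
            rwa [Ne, Finset.sdiff_eq_empty_iff_subset, Finset.univ_subset_iff]
          rw [segment, optTest_restrAtom _ this] at h
          simp at h
        · simp [segment] at h
      obtain ⟨rfl, rfl⟩ := hu
      rw [h]
      simp only [lastAtom_nil, List.nil_append]
      rcases segment_univ_head Z x.2 v with h | ⟨t, w, h, -⟩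
      · rw [h]
        exact .nil_right _
      · rw [h]
        exact .prog_test _ _ _ _
    · have := (ih (X := Finset.univ) (α := x.2) (fun _ => Finset.subset_univ _)).append_left h
        (optTest (restrAtom α X) ++ [Symb.prog x.1])
      simpa using this

/-- With target `∅` the last test is not truncated. Every atom after a program is spelled on all of
`B`, and only the first atom is restricted, namely to `X`. -/
theorem segment_injective {X : Finset B} {α α' : B → Bool} {u u' : List (P × (B → Bool))}
    (h : segment ∅ X α u = segment ∅ X α' u') : u = u' ∧ ∀ b ∈ X, α b = α' b := by
  have key : ∀ {S S' : Finset B} {α α' : B → Bool} {p p' : P} {w w' : List (Symb P B)},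
      optTest (restrAtom α S) ++ Symb.prog p :: w = optTest (restrAtom α' S') ++ Symb.prog p' :: w' →
      restrAtom α S = restrAtom α' S' ∧ p = p' ∧ w = w' := by
    intro S S' α α' p p' w w' h
    simp only [optTest] at h
    split_ifs at h with h1 h2 h2 <;> simp_all
  have key' : ∀ {t s : Finset (Literal B)} {p : P} {w : List (Symb P B)},
      optTest t ≠ optTest s ++ Symb.prog p :: w := by
    intro t s p w h
    simp only [optTest] at h
    split_ifs at h <;> simp_all
  induction u generalizing X α α' u' with
  | nil =>
    rcases u' with _ | ⟨x, u'⟩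
    · refine ⟨rfl, ?_⟩
      simp only [segment, Finset.sdiff_empty] at h
      by_cases hX : X = ∅
      · simp [hX]
      · rw [optTest_restrAtom _ hX, optTest_restrAtom _ hX] at h
        exact restrAtom_congr_iff.1 (by simpa using h)
    · exact absurd h key'
  | cons x u ih =>
    rcases u' with _ | ⟨x', u'⟩
    · exact absurd h.symm key'
    · obtain ⟨h1, h2, h3⟩ := key h
      obtain ⟨rfl, h4⟩ := ih h3
      refine ⟨?_, restrAtom_congr_iff.1 h1⟩
      rw [show x = x' from Prod.ext h2 (funext fun b => h4 b (Finset.mem_univ b))]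

end Segments

/-! ### Mixed languages versus guarded languages -/

section Language

variable {P B : Type*} [Fintype B] [DecidableEq B]

/-- The mixed string of type `X → Y` that spells a guarded string. -/
def segmentString [Nonempty B] (X Y : Finset B) (α : B → Bool) (u : List (P × (B → Bool))) :
    MixedString P B :=
  ⟨segment Y X α u, isMixedString_segment X Y α u⟩

/-- The mixed language `L` spells the guarded language `G`, at the type `X → Y`. -/
def Spells (X Y : Finset B) (G : (B → Bool) → List (P × (B → Bool)) → Prop)
    (L : Set (MixedString P B)) : Prop :=
  ∀ σ : MixedString P B, σ ∈ L ↔ ∃ α u, G α u ∧ σ.1 = segment Y X α u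

theorem Spells.fusion [Nonempty B] {X Y Z : Finset B}
    {G H : (B → Bool) → List (P × (B → Bool)) → Prop} {K L : Set (MixedString P B)}
    (hG : IsTyped X Y G) (hH : IsTyped Y Z H) (hK : Spells X Y G K) (hL : Spells Y Z H L) :
    Spells X Z (fusion G H) (langMul K L) := by
  intro ρ
  constructor
  · rintro ⟨σ, hσ, τ, hτ, h⟩
    obtain ⟨α, u, hu, hσ⟩ := (hK σ).1 hσ
    obtain ⟨β, v, hv, hτ⟩ := (hL τ).1 hτ
    -- The atom at the junction combines the two strings: values on `Y` come from the right one, all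
    -- others from the left one. By the typing conditions neither language notices the change, and
    -- neither spelling is altered.
    set γ : B → Bool := fun b => if b ∈ Y then β b else lastAtom α u b with hγ
    have h1 : ∀ b ∉ Y, γ b = lastAtom α u b := fun b hb => by simp [hγ, hb]
    have h2 : ∀ b ∈ Y, β b = γ b := fun b hb => by simp [hγ, hb]
    have hu' := hG.congr_last α u γ h1 hu
    have hv' := hH.congr_first _ _ _ h2 hv
    rw [← segment_setLast h1] at hσ
    rw [segment_congr_first h2] at hτ
    refine ⟨_, _, ⟨_, v, rfl, hu', by rwa [lastAtom_setLast]⟩, ?_⟩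
    have hJ := joins_segment (X := X) (Y := Y) (Z := Z) (α := (setLast γ α u).1)
      (u := (setLast γ α u).2) (v := v) (fun h => hG.subset (setLast γ α u).1 (h ▸ hu'))
      (fun h => hH.subset γ (h ▸ hv'))
    rw [lastAtom_setLast, ← hσ, ← hτ] at hJ
    exact Joins.unique h hJ
  · rintro ⟨α, _, ⟨u, v, rfl, hu, hv⟩, hρ⟩
    refine ⟨segmentString X Y α u, (hK _).2 ⟨α, u, hu, rfl⟩,
      segmentString Y Z (lastAtom α u) v, (hL _).2 ⟨_, v, hv, rfl⟩, ?_⟩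
    unfold IsConcat
    rw [hρ]
    exact joins_segment (fun h => hG.subset α (h ▸ hu))
      (fun h => hH.subset (lastAtom α u) (h ▸ hv))

theorem spells_nil (X : Finset B) :
    Spells (P := P) X X (fun _ u => u = []) {MixedString.nil} := by
  intro σ
  rw [Set.mem_singleton_iff]
  constructor
  · rintro rfl
    exact ⟨fun _ => true, [], rfl, by simp [segment, MixedString.nil]⟩
  · rintro ⟨α, u, rfl, h⟩
    exact Subtype.ext (h.trans (by simp [segment, MixedString.nil]))

theorem TypeDeriv.spells [Nonempty B] {e : Expr P B} {X Y : Finset B} (d : TypeDeriv e X Y) :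
    Spells X Y (guarded e) (lang e) := by
  induction d with
  | zero => intro σ; simp [lang, guarded]
  | one X => exact spells_nil X
  | prog p =>
    intro σ
    rw [lang, Set.mem_singleton_iff]
    constructor
    · rintro rfl
      exact ⟨fun _ => true, [(p, fun _ => true)], ⟨_, rfl⟩, by simp [segment, MixedString.ofProg]⟩
    · rintro ⟨α, u, ⟨α', rfl⟩, h⟩
      exact Subtype.ext (h.trans (by simp [segment, MixedString.ofProg]))
  | lit l X =>
    intro σ
    have hs : insert l.1 X \ X.erase l.1 = {l.1} := by
      ext b
      simp only [Finset.mem_sdiff, Finset.mem_insert, Finset.mem_erase, Finset.mem_singleton]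
      tauto
    rw [lang, Set.mem_singleton_iff]
    constructor
    · rintro rfl
      refine ⟨fun _ => l.2, [], ⟨rfl, rfl⟩, ?_⟩
      rw [segment, hs, optTest_restrAtom _ (by simp)]
      simp [restrAtom, MixedString.ofLit]
    · rintro ⟨α, u, ⟨rfl, h'⟩, h⟩
      rw [segment, hs, optTest_restrAtom _ (by simp)] at h
      refine Subtype.ext (h.trans ?_)
      simp [restrAtom, MixedString.ofLit, h']
  | add d d' ih ih' =>
    intro σ
    rw [lang, Set.mem_union, ih σ, ih' σ]
    simp only [guarded, or_and_right, exists_or]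
  | mul d d' ih ih' => exact Spells.fusion d.isTyped d'.isTyped ih ih'
  | @star e X d ih =>
    have key : ∀ n, Spells X X (fusionPow (guarded e) n) (langPow (lang e) n) := by
      intro n
      induction n with
      | zero => exact spells_nil X
      | succ n ihn => exact Spells.fusion d.isTyped (d.isTyped.fusionPow n) ih ihn
    intro σ
    simp only [lang, Set.mem_iUnion, guarded, key _ σ]
    constructor
    · rintro ⟨n, α, u, h, h'⟩
      exact ⟨α, u, ⟨n, h⟩, h'⟩
    · rintro ⟨α, u, ⟨n, h⟩, h'⟩
      exact ⟨n, α, u, h, h'⟩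

/-- At a type `A → ∅`, the mixed language and the guarded language determine each other. -/
theorem lang_eq_iff_guarded_eq [Nonempty B] {e f : Expr P B} {A : Finset B} (he : HasType e A ∅)
    (hf : HasType f A ∅) : lang e = lang f ↔ guarded e = guarded f := by
  obtain ⟨d⟩ := he
  obtain ⟨d'⟩ := hf
  constructor
  · have key : ∀ {e f : Expr P B}, TypeDeriv e A ∅ → TypeDeriv f A ∅ → lang e = lang f →
        ∀ α u, guarded e α u → guarded f α u := by
      intro e f d d' h α u hu
      have h1 := (d.spells (segmentString A ∅ α u)).2 ⟨α, u, hu, rfl⟩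
      rw [h, d'.spells] at h1
      obtain ⟨α', u', hu', h1⟩ := h1
      obtain ⟨rfl, h2⟩ := segment_injective h1
      exact d'.isTyped.congr_first _ _ _ (fun b hb => (h2 b hb).symm) hu'
    intro h
    funext α u
    exact propext ⟨key d d' h α u, key d' d h.symm α u⟩
  · intro h
    ext σ
    rw [d.spells, d'.spells, h]

end Language

/-! ### Sums up to associativity, commutativity and idempotence -/

section Sums

variable {P B : Type*}

/-- The sum of a list of expressions. -/
def sumList (L : List (Expr P B)) : Expr P B := L.foldr .add .zero

@[simp] theorem sumList_nil : sumList ([] : List (Expr P B)) = .zero := rfl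

@[simp] theorem sumList_cons (e : Expr P B) (L : List (Expr P B)) :
    sumList (e :: L) = .add e (sumList L) := rfl

theorem AciEq.add_sumList_of_mem {e : Expr P B} {L : List (Expr P B)} (h : e ∈ L) :
    AciEq (.add e (sumList L)) (sumList L) := by
  induction L with
  | nil => simp at h
  | cons f L ih =>
    rcases List.mem_cons.1 h with rfl | h
    · exact (AciEq.assoc _ _ _).trans (.add (.idem _) (.refl _))
    · refine (AciEq.assoc _ _ _).trans ((AciEq.add (.comm _ _) (.refl _)).trans ?_)
      exact (AciEq.assoc _ _ _).symm.trans (.add (.refl _) (ih h))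

theorem AciEq.sumList_add_of_subset {L L' : List (Expr P B)} (h : L ⊆ L') :
    AciEq (.add (sumList L) (sumList L')) (sumList L') := by
  induction L with
  | nil => exact .zero_add _
  | cons e L ih =>
    rw [List.cons_subset] at h
    refine (AciEq.assoc _ _ _).symm.trans ((AciEq.add (.refl _) (ih h.2)).trans ?_)
    exact .add_sumList_of_mem h.1

theorem AciEq.sumList_of_subset {L L' : List (Expr P B)} (h : L ⊆ L') (h' : L' ⊆ L) :
    AciEq (sumList L) (sumList L') :=
  ((AciEq.sumList_add_of_subset h').symm.trans (.comm _ _)).trans (.sumList_add_of_subset h)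

theorem AciEq.sumList_append (L L' : List (Expr P B)) :
    AciEq (sumList (L ++ L')) (.add (sumList L) (sumList L')) := by
  induction L with
  | nil => exact (AciEq.zero_add _).symm
  | cons e L ih => exact (AciEq.add (.refl _) ih).trans (.assoc _ _ _)

/-- The expression is, up to `AciEq`, a sum of expressions in `K`. -/
def InSpan (K : Finset (Expr P B)) (e : Expr P B) : Prop :=
  ∃ F ⊆ K, AciEq e (sumList F.toList)

theorem InSpan.of_aciEq {K : Finset (Expr P B)} {e f : Expr P B} (h : AciEq e f)
    (hf : InSpan K f) : InSpan K e := by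
  obtain ⟨F, hF, hf⟩ := hf
  exact ⟨F, hF, h.trans hf⟩

theorem InSpan.zero (K : Finset (Expr P B)) : InSpan K .zero :=
  ⟨∅, Finset.empty_subset _, by simpa using AciEq.refl _⟩

theorem InSpan.of_mem {K : Finset (Expr P B)} {e f : Expr P B} (h : AciEq e f) (hf : f ∈ K) :
    InSpan K e :=
  ⟨{f}, by simpa using hf, by simpa using h.trans (AciEq.add_zero _).symm⟩

variable [DecidableEq (Expr P B)]

theorem InSpan.add {K : Finset (Expr P B)} {e f : Expr P B} (he : InSpan K e) (hf : InSpan K f) :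
    InSpan K (.add e f) := by
  obtain ⟨F, hF, he⟩ := he
  obtain ⟨G, hG, hf⟩ := hf
  refine ⟨F ∪ G, Finset.union_subset hF hG, (AciEq.add he hf).trans ?_⟩
  refine (AciEq.sumList_append _ _).symm.trans (.sumList_of_subset ?_ ?_) <;> intro a <;> simp

/-- All sums of expressions in `K`. -/
noncomputable def spanFinset (K : Finset (Expr P B)) : Finset (Expr P B) :=
  K.powerset.image fun F => sumList F.toList

theorem inSpan_iff {K : Finset (Expr P B)} {e : Expr P B} :
    InSpan K e ↔ ∃ s ∈ spanFinset K, AciEq e s := by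
  simp [InSpan, spanFinset]

theorem card_spanFinset_le (K : Finset (Expr P B)) : (spanFinset K).card ≤ 2 ^ K.card :=
  Finset.card_image_le.trans (Finset.card_powerset K).le

end Sums

/-! ### Finite families closed under derivatives -/

section Systems

variable {P B : Type*} [Fintype B] [DecidableEq B]

/-- At the type `Z → Y`, the derivatives of `e` belong to the family `S` up to `AciEq`. -/
def HasDerivsIn (S : Finset B → Finset (Expr P B)) (Y Z : Finset B) (e : Expr P B) : Prop :=
  ∃ d : TypeDeriv e Z Y,
    (∀ l : Literal B, l.1 ∈ Z → ∃ s ∈ S (Z.erase l.1), AciEq (litDeriv l d) s) ∧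
    (Z = ∅ → ∀ p : P, ∃ s ∈ S Finset.univ, AciEq (progDeriv p d) s)

/-- The family `S` of sets of expressions with target `Y` is closed under derivatives. -/
def IsClosedSystem (S : Finset B → Finset (Expr P B)) (Y : Finset B) : Prop :=
  ∀ Z, ∀ s ∈ S Z, HasDerivsIn S Y Z s

/-- A family of sets of tests that is closed under derivatives and under the addition of a
primitive test that remains to be tested. -/
def IsClosedTests (T : Finset B → Finset B → Finset (Expr P B)) : Prop :=
  ∀ Z N, ∀ t ∈ T Z N, testHat t = t ∧ ∃ d : TypeDeriv t Z N,
    (∀ l : Literal B, l.1 ∈ Z → ∃ t' ∈ T (Z.erase l.1) N, AciEq (litDeriv l d) t') ∧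
    (∀ b ∈ N, ∃ t' ∈ T (Z.erase b) (N.erase b), AciEq t t')

variable [DecidableEq (Expr P B)]

theorem hasDerivsIn_sumList {K : Finset B → Finset (Expr P B)} {Y Z : Finset B}
    {L : List (Expr P B)} (h : ∀ k ∈ L, HasDerivsIn (fun Z => spanFinset (K Z)) Y Z k) :
    HasDerivsIn (fun Z => spanFinset (K Z)) Y Z (sumList L) := by
  induction L with
  | nil =>
    refine ⟨.zero _ _, fun l _ => ?_, fun _ p => ?_⟩
    · exact inSpan_iff.1 (InSpan.zero _)
    · exact inSpan_iff.1 (InSpan.zero _)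
  | cons e L ih =>
    obtain ⟨d, h1, h2⟩ := h e (by simp)
    obtain ⟨d', h1', h2'⟩ := ih fun k hk => h k (List.mem_cons_of_mem _ hk)
    refine ⟨.add d d', fun l hl => ?_, fun hZ p => ?_⟩
    · exact inSpan_iff.1 (InSpan.add (inSpan_iff.2 (h1 l hl)) (inSpan_iff.2 (h1' l hl)))
    · exact inSpan_iff.1 (InSpan.add (inSpan_iff.2 (h2 hZ p)) (inSpan_iff.2 (h2' hZ p)))

theorem isClosedSystem_span {K : Finset B → Finset (Expr P B)} {Y : Finset B}
    (h : ∀ Z, ∀ k ∈ K Z, HasDerivsIn (fun Z => spanFinset (K Z)) Y Z k) :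
    IsClosedSystem (fun Z => spanFinset (K Z)) Y := by
  intro Z s hs
  simp only [spanFinset, Finset.mem_image, Finset.mem_powerset] at hs
  obtain ⟨F, hF, rfl⟩ := hs
  exact hasDerivsIn_sumList fun k hk => h Z k (hF (Finset.mem_toList.1 hk))

omit [DecidableEq (Expr P B)] in
theorem HasDerivsIn.mono {S S' : Finset B → Finset (Expr P B)} {Y Z : Finset B} {e : Expr P B}
    (h : HasDerivsIn S Y Z e) (hS : ∀ Z, S Z ⊆ S' Z) : HasDerivsIn S' Y Z e := by
  obtain ⟨d, h1, h2⟩ := h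
  refine ⟨d, fun l hl => ?_, fun hZ p => ?_⟩
  · obtain ⟨s, hs, h⟩ := h1 l hl
    exact ⟨s, hS _ hs, h⟩
  · obtain ⟨s, hs, h⟩ := h2 hZ p
    exact ⟨s, hS _ hs, h⟩

theorem HasDerivsIn.span {S K : Finset B → Finset (Expr P B)} {Y Z : Finset B} {e : Expr P B}
    (h : HasDerivsIn S Y Z e) (hS : ∀ Z, S Z ⊆ K Z) :
    HasDerivsIn (fun Z => spanFinset (K Z)) Y Z e := by
  obtain ⟨d, h1, h2⟩ := h
  refine ⟨d, fun l hl => ?_, fun hZ p => ?_⟩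
  · obtain ⟨s, hs, h⟩ := h1 l hl
    exact inSpan_iff.1 (.of_mem h (hS _ hs))
  · obtain ⟨s, hs, h⟩ := h2 hZ p
    exact inSpan_iff.1 (.of_mem h (hS _ hs))

/-- A closed system with at most `n` expressions at each source contains `e : X → Y`. -/
def HasSystem (n : ℕ) (e : Expr P B) (X Y : Finset B) : Prop :=
  ∃ S : Finset B → Finset (Expr P B), IsClosedSystem S Y ∧ e ∈ S X ∧ ∀ Z, (S Z).card ≤ n

omit [DecidableEq (Expr P B)] in
theorem HasSystem.mono {m n : ℕ} (hmn : m ≤ n) {e : Expr P B} {X Y : Finset B}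
    (h : HasSystem m e X Y) : HasSystem n e X Y := by
  obtain ⟨S, h1, h2, h3⟩ := h
  exact ⟨S, h1, h2, fun Z => (h3 Z).trans hmn⟩

/-- Derivatives are additive, so the sums of generators form a closed system once the derivatives of
the generators are such sums. There are at most `2 ^ m` sums; the extra element is `e`, which need
not be one of them. -/
theorem hasSystem_of_generators {K : Finset B → Finset (Expr P B)} {X Y : Finset B}
    {e : Expr P B} {m : ℕ} (h : ∀ Z, ∀ k ∈ K Z, HasDerivsIn (fun Z => spanFinset (K Z)) Y Z k)
    (he : HasDerivsIn (fun Z => spanFinset (K Z)) Y X e) (hm : ∀ Z, (K Z).card ≤ m) :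
    HasSystem (2 ^ m + 1) e X Y := by
  have hsub : ∀ Z, spanFinset (K Z) ⊆
      (fun Z => if Z = X then insert e (spanFinset (K Z)) else spanFinset (K Z)) Z := by
    intro Z
    dsimp only
    split_ifs
    · exact Finset.subset_insert _ _
    · exact subset_rfl
  refine ⟨fun Z => if Z = X then insert e (spanFinset (K Z)) else spanFinset (K Z), ?_, ?_, ?_⟩
  · intro Z s hs
    dsimp only at hs
    split_ifs at hs with hZ
    · rcases Finset.mem_insert.1 hs with rfl | hs
      · subst hZ
        exact he.mono hsub
      · exact (isClosedSystem_span h Z s hs).mono hsub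
    · exact (isClosedSystem_span h Z s hs).mono hsub
  · simp
  · intro Z
    have h1 : (spanFinset (K Z)).card ≤ 2 ^ m :=
      (card_spanFinset_le _).trans (Nat.pow_le_pow_right (by norm_num) (hm Z))
    dsimp only
    split_ifs
    · exact (Finset.card_insert_le _ _).trans (Nat.succ_le_succ h1)
    · exact h1.trans (Nat.le_succ _)

theorem IsClosedTests.biUnion {ι : Type*} [Fintype ι]
    {T : ι → Finset B → Finset B → Finset (Expr P B)} (h : ∀ i, IsClosedTests (T i)) :
    IsClosedTests fun Z N => Finset.univ.biUnion fun i => T i Z N := by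
  intro Z N t ht
  obtain ⟨i, -, ht⟩ := Finset.mem_biUnion.1 ht
  have hsub : ∀ Z N, T i Z N ⊆ Finset.univ.biUnion fun i => T i Z N :=
    fun Z N => Finset.subset_biUnion_of_mem (fun i => T i Z N) (Finset.mem_univ i)
  obtain ⟨h1, d, h2, h3⟩ := h i Z N t ht
  refine ⟨h1, d, fun l hl => ?_, fun b hb => ?_⟩
  · obtain ⟨t', ht', h⟩ := h2 l hl
    exact ⟨t', hsub _ _ ht', h⟩
  · obtain ⟨t', ht', h⟩ := h3 b hb
    exact ⟨t', hsub _ _ ht', h⟩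

omit [DecidableEq (Expr P B)] in
theorem isClosedTests_zero : IsClosedTests fun _ _ => ({.zero} : Finset (Expr P B)) := by
  intro Z N t ht
  obtain rfl := Finset.mem_singleton.1 ht
  exact ⟨rfl, .zero _ _, fun l _ => ⟨.zero, by simp, .refl _⟩, fun b _ => ⟨.zero, by simp, .refl _⟩⟩

/-- Both operations on a test `t : Z → N` shrink its source: a derivative removes the base of the
literal, and erasing `b ∈ N` removes `b` from `Z`, unless `b ∉ Z`, where `t` is null and `0` takes
its place. Induction on the size of the source therefore ends, with a bound that does not depend on
`t`. -/
theorem exists_isClosedTests_of_card_lt (P B : Type*) [Fintype B] [DecidableEq B]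
    [DecidableEq (Expr P B)] (m : ℕ) : ∃ C : ℕ, 0 < C ∧ ∀ (Z N : Finset B) (t : Expr P B),
      Z.card < m → testHat t = t → HasType t Z N →
        ∃ T : Finset B → Finset B → Finset (Expr P B), IsClosedTests T ∧ t ∈ T Z N ∧
          ∀ Z' N', (T Z' N').card ≤ C := by
  induction m with
  | zero => exact ⟨1, one_pos, fun Z N t h => absurd h (Nat.not_lt_zero _)⟩
  | succ m ih =>
    obtain ⟨C, hC, ih⟩ := ih
    -- The summands count `0`, the test `t` itself, one smaller family for each literal, and one for
    -- each erased primitive test.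
    refine ⟨1 + (1 + (Fintype.card (Literal B) * C + Fintype.card B * C)), by omega,
      fun Z N t hZ ht hd => ?_⟩
    obtain ⟨d⟩ := hd
    have hl : ∀ l : Literal B, ∃ T : Finset B → Finset B → Finset (Expr P B), IsClosedTests T ∧
        (l.1 ∈ Z → ∃ t' ∈ T (Z.erase l.1) N, AciEq (litDeriv l d) t') ∧
        ∀ Z' N', (T Z' N').card ≤ C := by
      intro l
      by_cases hl : l.1 ∈ Z
      · obtain ⟨t', h1, h2, h3⟩ := d.exists_litDeriv_of_testHat ht l hl
        have := Finset.card_erase_lt_of_mem hl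
        obtain ⟨T, hT, h4, h5⟩ := ih (Z.erase l.1) N t' (by omega) h1 h3
        exact ⟨T, hT, fun _ => ⟨t', h4, h2⟩, h5⟩
      · exact ⟨_, isClosedTests_zero, fun h => absurd h hl, fun _ _ => (Finset.card_singleton _).trans_le hC⟩
    have hb : ∀ b : B, ∃ T : Finset B → Finset B → Finset (Expr P B), IsClosedTests T ∧
        (b ∈ N → b ∈ Z → ∃ t' ∈ T (Z.erase b) (N.erase b), AciEq t t') ∧
        ∀ Z' N', (T Z' N').card ≤ C := by
      intro b
      by_cases hb : b ∈ N ∧ b ∈ Z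
      · obtain ⟨t', h1, h2, h3⟩ := d.exists_testHat_erase hb.1
        have := Finset.card_erase_lt_of_mem hb.2
        obtain ⟨T, hT, h4, h5⟩ := ih (Z.erase b) (N.erase b) t' (by omega) h1 h3
        exact ⟨T, hT, fun _ _ => ⟨t', h4, ht ▸ h2⟩, h5⟩
      · exact ⟨_, isClosedTests_zero, fun h h' => absurd ⟨h, h'⟩ hb, fun _ _ => (Finset.card_singleton _).trans_le hC⟩
    choose T1 hT1 h1 hc1 using hl
    choose T2 hT2 h2 hc2 using hb
    have hU1 := IsClosedTests.biUnion hT1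
    have hU2 := IsClosedTests.biUnion hT2
    have hz := isClosedTests_zero (P := P) (B := B)
    set U1 : Finset B → Finset B → Finset (Expr P B) :=
      fun Z N => Finset.univ.biUnion fun i => T1 i Z N with hU1def
    set U2 : Finset B → Finset B → Finset (Expr P B) :=
      fun Z N => Finset.univ.biUnion fun i => T2 i Z N with hU2def
    let T : Finset B → Finset B → Finset (Expr P B) := fun Z' N' =>
      {.zero} ∪ ((if Z' = Z ∧ N' = N then {t} else ∅) ∪ (U1 Z' N' ∪ U2 Z' N'))
    have mono : ∀ {V : Finset B → Finset B → Finset (Expr P B)}, IsClosedTests V →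
        (∀ Z' N', V Z' N' ⊆ T Z' N') → ∀ Z' N', ∀ t ∈ V Z' N', testHat t = t ∧
          ∃ d : TypeDeriv t Z' N',
            (∀ l : Literal B, l.1 ∈ Z' → ∃ t' ∈ T (Z'.erase l.1) N', AciEq (litDeriv l d) t') ∧
            (∀ b ∈ N', ∃ t' ∈ T (Z'.erase b) (N'.erase b), AciEq t t') := by
      intro V hV hsub Z' N' t ht
      obtain ⟨h1, d, h2, h3⟩ := hV Z' N' t ht
      refine ⟨h1, d, fun l hl => ?_, fun b hb => ?_⟩
      · obtain ⟨t', ht', h⟩ := h2 l hl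
        exact ⟨t', hsub _ _ ht', h⟩
      · obtain ⟨t', ht', h⟩ := h3 b hb
        exact ⟨t', hsub _ _ ht', h⟩
    have s0 : ∀ Z' N', ({.zero} : Finset (Expr P B)) ⊆ T Z' N' :=
      fun Z' N' => Finset.subset_union_left
    have s1 : ∀ Z' N', U1 Z' N' ⊆ T Z' N' := fun Z' N' a ha => by simp [T, ha]
    have s2 : ∀ Z' N', U2 Z' N' ⊆ T Z' N' := fun Z' N' a ha => by simp [T, ha]
    refine ⟨T, ?_, by simp [T], ?_⟩
    · intro Z' N' a ha
      rcases Finset.mem_union.1 ha with ha' | ha'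
      · exact mono hz s0 _ _ a ha'
      rcases Finset.mem_union.1 ha' with hat | ha'
      · split_ifs at hat with hc
        · obtain ⟨rfl, rfl⟩ := hc
          obtain rfl := Finset.mem_singleton.1 hat
          refine ⟨ht, d, fun l hl => ?_, fun b hb => ?_⟩
          · obtain ⟨t', ht', h⟩ := h1 l hl
            exact ⟨t', s1 _ _ (Finset.mem_biUnion.2 ⟨l, Finset.mem_univ _, ht'⟩), h⟩
          · by_cases hbZ : b ∈ Z'
            · obtain ⟨t', ht', h⟩ := h2 b hb hbZ
              exact ⟨t', s2 _ _ (Finset.mem_biUnion.2 ⟨b, Finset.mem_univ _, ht'⟩), h⟩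
            · exact ⟨.zero, by simp [T], ht ▸ (d.isNull_testHat hb hbZ).aciEq_zero⟩
        · simp at hat
      rcases Finset.mem_union.1 ha' with ha' | ha'
      · exact mono hU1 s1 _ _ a ha'
      · exact mono hU2 s2 _ _ a ha'
    · intro Z' N'
      refine (Finset.card_union_le _ _).trans (Nat.add_le_add (by simp) ?_)
      refine (Finset.card_union_le _ _).trans (Nat.add_le_add (by split_ifs <;> simp) ?_)
      refine (Finset.card_union_le _ _).trans (Nat.add_le_add ?_ ?_)
      · exact Finset.card_biUnion_le_card_mul _ _ _ fun l _ => hc1 l Z' N'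
      · exact Finset.card_biUnion_le_card_mul _ _ _ fun b _ => hc2 b Z' N'

/-- The tests of the expressions of a closed system lie in a closed family of tests. -/
theorem exists_isClosedTests (P B : Type*) [Fintype B] [DecidableEq B]
    [DecidableEq (Expr P B)] : ∃ C : ℕ, ∀ (n : ℕ) (S : Finset B → Finset (Expr P B))
      (M : Finset B), IsClosedSystem S M → (∀ Z, (S Z).card ≤ n) →
        ∃ T : Finset B → Finset B → Finset (Expr P B), IsClosedTests T ∧
          (∀ Z, ∀ s ∈ S Z, ∀ b ∈ M, ∃ t ∈ T (Z.erase b) (M.erase b), AciEq (testHat s) t) ∧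
          ∀ Z N, (T Z N).card ≤ C * n := by
  obtain ⟨C, hC, h⟩ := exists_isClosedTests_of_card_lt P B (Fintype.card B + 1)
  -- There is one family of size at most `C` for each triple of a source `Z`, a member of `S Z` and
  -- an erased test `b`.
  refine ⟨Fintype.card (Finset B) * (Fintype.card B * C), fun n S M hS hn => ?_⟩
  have key : ∀ i : (Σ Z : Finset B, S Z) × B, ∃ T : Finset B → Finset B → Finset (Expr P B),
      IsClosedTests T ∧ (i.2 ∈ M → ∃ t ∈ T (i.1.1.erase i.2) (M.erase i.2),
        AciEq (testHat i.1.2.1) t) ∧ ∀ Z N, (T Z N).card ≤ C := by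
    rintro ⟨⟨Z, s, hs⟩, b⟩
    by_cases hb : b ∈ M
    · obtain ⟨d, -, -⟩ := hS Z s hs
      obtain ⟨t, h1, h2, h3⟩ := d.exists_testHat_erase hb
      obtain ⟨T, hT, h4, h5⟩ := h (Z.erase b) (M.erase b) t
        (Nat.lt_succ_of_le (Finset.card_le_univ _)) h1 h3
      exact ⟨T, hT, fun _ => ⟨t, h4, h2⟩, h5⟩
    · exact ⟨_, isClosedTests_zero, fun h => absurd h hb, fun _ _ => (Finset.card_singleton _).trans_le hC⟩
  choose T hT h1 h2 using key
  refine ⟨_, IsClosedTests.biUnion hT, fun Z s hs b hb => ?_, fun Z N => ?_⟩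
  · obtain ⟨t, ht, h⟩ := h1 ⟨⟨Z, s, hs⟩, b⟩ hb
    exact ⟨t, Finset.mem_biUnion.2 ⟨_, Finset.mem_univ _, ht⟩, h⟩
  · refine (Finset.card_biUnion_le_card_mul _ _ _ fun i _ => h2 i Z N).trans ?_
    rw [Finset.card_univ, Fintype.card_prod, Fintype.card_sigma]
    simp only [Fintype.card_coe]
    have : ∑ Z : Finset B, (S Z).card ≤ Fintype.card (Finset B) * n := by
      simpa using Finset.sum_le_card_nsmul Finset.univ (fun Z => (S Z).card) n fun Z _ => hn Z
    calc _ ≤ (Fintype.card (Finset B) * n) * Fintype.card B * C := by gcongr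
      _ = _ := by ring

end Systems

/-! ### Closed systems for all typed expressions -/

section Existence

variable {P B : Type*} [Fintype B] [DecidableEq B] [DecidableEq (Expr P B)]

theorem hasDerivsIn_span {K : Finset B → Finset (Expr P B)} {Y Z : Finset B} {e : Expr P B}
    (d : TypeDeriv e Z Y)
    (h : ∀ l : Literal B, l.1 ∈ Z → InSpan (K (Z.erase l.1)) (litDeriv l d))
    (h' : Z = ∅ → ∀ p : P, InSpan (K Finset.univ) (progDeriv p d)) :
    HasDerivsIn (fun Z => spanFinset (K Z)) Y Z e :=
  ⟨d, fun l hl => inSpan_iff.1 (h l hl), fun hZ p => inSpan_iff.1 (h' hZ p)⟩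

/-- The only generator is `1`, placed at source `Y`; the bound is `2 ^ 1 + 1`. -/
theorem hasSystem_of_constant {X Y : Finset B} {e : Expr P B} (d : TypeDeriv e X Y)
    (h : ∀ l : Literal B, l.1 ∈ X → litDeriv l d = .zero ∨
      (litDeriv l d = .one ∧ X.erase l.1 = Y))
    (h' : X = ∅ → ∀ p : P, progDeriv p d = .zero ∨ (progDeriv p d = .one ∧ Finset.univ = Y)) :
    HasSystem 3 e X Y := by
  have hK : ∀ Z, Z = Y → (.one : Expr P B) ∈ (if Z = Y then {Expr.one} else ∅ : Finset (Expr P B)) := by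
    intro Z hZ
    simp [hZ]
  refine hasSystem_of_generators (K := fun Z => if Z = Y then {.one} else ∅) (m := 1) ?_
    (hasDerivsIn_span d ?_ ?_) ?_
  · intro Z k hk
    split_ifs at hk with hZ
    · obtain rfl := Finset.mem_singleton.1 hk
      subst hZ
      exact hasDerivsIn_span (.one _) (fun _ _ => .zero _) (fun _ _ => .zero _)
    · simp at hk
  · intro l hl
    rcases h l hl with h | ⟨h, hY⟩
    · rw [h]
      exact .zero _
    · rw [h]
      exact .of_mem (.refl _) (hK _ hY)
  · intro hX p
    rcases h' hX p with h | ⟨h, hY⟩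
    · rw [h]
      exact .zero _
    · rw [h]
      exact .of_mem (.refl _) (hK _ hY)
  · intro Z
    split_ifs <;> simp

theorem HasSystem.add {n : ℕ} {e f : Expr P B} {X Y : Finset B} (he : HasSystem n e X Y)
    (hf : HasSystem n f X Y) : HasSystem (2 ^ (n + n) + 1) (.add e f) X Y := by
  obtain ⟨S, hS, heS, hSn⟩ := he
  obtain ⟨S', hS', hfS, hSn'⟩ := hf
  have s1 : ∀ Z, S Z ⊆ S Z ∪ S' Z := fun Z => Finset.subset_union_left
  have s2 : ∀ Z, S' Z ⊆ S Z ∪ S' Z := fun Z => Finset.subset_union_right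
  refine hasSystem_of_generators (K := fun Z => S Z ∪ S' Z) ?_ ?_ fun Z =>
    (Finset.card_union_le _ _).trans (Nat.add_le_add (hSn Z) (hSn' Z))
  · intro Z k hk
    rcases Finset.mem_union.1 hk with hk | hk
    · exact (hS Z k hk).span s1
    · exact (hS' Z k hk).span s2
  · obtain ⟨d, h1, h2⟩ := (hS X e heS).span s1
    obtain ⟨d', h1', h2'⟩ := (hS' X f hfS).span s2
    exact hasDerivsIn_span (.add d d')
      (fun l hl => InSpan.add (inSpan_iff.2 (h1 l hl)) (inSpan_iff.2 (h1' l hl)))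
      (fun hZ p => InSpan.add (inSpan_iff.2 (h2 hZ p)) (inSpan_iff.2 (h2' hZ p)))

omit [Fintype B] [DecidableEq B] [DecidableEq (Expr P B)] in
theorem InSpan.epsHat_mul {K : Finset (Expr P B)} {f : Expr P B} (h : InSpan K f)
    (e : Expr P B) : InSpan K (.mul (epsHat e) f) := by
  rcases epsHat_zero_or_mul (e := e) f with ⟨-, h'⟩ | ⟨-, h'⟩
  · exact .of_aciEq h' (.zero _)
  · exact .of_aciEq h' h

/-- The generators are the products `s · f` with `s` from the system of `e`, the system of `f`, and
the products `t · g` of a test `t : Z → N` and a member `g` of the system of `f` at source `N`. The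
last kind absorbs the summands `testHat s · D f`: closedness of the tests under erasing lets the
derivative of `t · g` be of this kind again. The hypothesis `hC` is passed in so that one constant
`C` serves the whole induction on expressions. -/
theorem HasSystem.mul {C n : ℕ}
    (hC : ∀ (n : ℕ) (S : Finset B → Finset (Expr P B)) (M : Finset B), IsClosedSystem S M →
      (∀ Z, (S Z).card ≤ n) → ∃ T : Finset B → Finset B → Finset (Expr P B), IsClosedTests T ∧
        (∀ Z, ∀ s ∈ S Z, ∀ b ∈ M, ∃ t ∈ T (Z.erase b) (M.erase b), AciEq (testHat s) t) ∧
        ∀ Z N, (T Z N).card ≤ C * n) {e f : Expr P B} {X M Y : Finset B}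
    (he : HasSystem n e X M) (hf : HasSystem n f M Y) :
    HasSystem (2 ^ (n + n + Fintype.card (Finset B) * (C * n * n)) + 1) (.mul e f) X Y := by
  obtain ⟨S, hS, heS, hSn⟩ := he
  obtain ⟨S', hS', hfS, hSn'⟩ := hf
  obtain ⟨T, hT, hST, hTn⟩ := hC n S M hS hSn
  obtain ⟨df, hf1, hf2⟩ := hS' M f hfS
  set K : Finset B → Finset (Expr P B) := fun Z => (S Z).image (Expr.mul · f) ∪ S' Z ∪
    Finset.univ.biUnion fun N => (T Z N ×ˢ S' N).image fun q => Expr.mul q.1 q.2 with hK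
  have k1 : ∀ {Z : Finset B} {a s : Expr P B}, AciEq a s → s ∈ S Z →
      InSpan (K Z) (.mul a f) := by
    intro Z a s h hs
    refine .of_mem (.mul h (.refl _)) ?_
    simp only [hK, Finset.mem_union, Finset.mem_image]
    exact .inl (.inl ⟨s, hs, rfl⟩)
  have k2 : ∀ {Z : Finset B} {a s : Expr P B}, AciEq a s → s ∈ S' Z → InSpan (K Z) a := by
    intro Z a s h hs
    refine .of_mem h ?_
    simp only [hK, Finset.mem_union]
    exact .inl (.inr hs)
  have k3 : ∀ {Z N : Finset B} {a t a' s : Expr P B}, AciEq a t → t ∈ T Z N → AciEq a' s →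
      s ∈ S' N → InSpan (K Z) (.mul a a') := by
    intro Z N a t a' s h ht h' hs
    refine .of_mem (.mul h h') ?_
    simp only [hK, Finset.mem_union, Finset.mem_biUnion, Finset.mem_image, Finset.mem_product]
    exact .inr ⟨N, Finset.mem_univ _, (t, s), ⟨ht, hs⟩, rfl⟩
  have g1 : ∀ Z, ∀ s ∈ S Z, HasDerivsIn (fun Z => spanFinset (K Z)) Y Z (.mul s f) := by
    intro Z s hs
    obtain ⟨d, h1, h2⟩ := hS Z s hs
    refine hasDerivsIn_span (.mul d df) (fun l hl => ?_) (fun hZ p => ?_)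
    · obtain ⟨s', hs', h⟩ := h1 l hl
      simp only [litDeriv]
      split_ifs with hM
      · obtain ⟨t, ht, h3⟩ := hST Z s hs l.1 hM
        obtain ⟨g, hg, h4⟩ := hf1 l hM
        exact .add (k1 h hs') (k3 h3 ht h4 hg)
      · exact k1 h hs'
    · obtain ⟨s', hs', h⟩ := h2 hZ p
      simp only [progDeriv]
      split_ifs with hM
      · obtain ⟨g, hg, h4⟩ := hf2 hM p
        exact .add (k1 h hs') ((k2 h4 hg).epsHat_mul s)
      · exact k1 h hs'
  refine hasSystem_of_generators (K := K) ?_ (g1 X e heS) ?_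
  · intro Z k hk
    simp only [hK, Finset.mem_union, Finset.mem_biUnion, Finset.mem_image,
      Finset.mem_product] at hk
    rcases hk with (⟨s, hs, rfl⟩ | hk) | ⟨N, -, ⟨t, g⟩, ⟨ht, hg⟩, rfl⟩
    · exact g1 Z s hs
    · refine (hS' Z k hk).span fun Z a ha => ?_
      simp only [hK, Finset.mem_union]
      exact .inl (.inr ha)
    · obtain ⟨htt, dt, ht1, ht2⟩ := hT Z N t ht
      obtain ⟨dg, hg1, hg2⟩ := hS' N g hg
      refine hasDerivsIn_span (.mul dt dg) (fun l hl => ?_) (fun hZ p => ?_)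
      · obtain ⟨t', ht', h⟩ := ht1 l hl
        have h0 := k3 h ht' (.refl g) hg
        simp only [litDeriv]
        split_ifs with hN
        · obtain ⟨t'', ht'', h3⟩ := ht2 l.1 hN
          obtain ⟨g', hg', h4⟩ := hg1 l hN
          exact .add h0 (k3 (by rw [htt]; exact h3) ht'' h4 hg')
        · exact h0
      · have h0 : InSpan (K Finset.univ) (.mul (progDeriv p dt) g) :=
          .of_aciEq (AciEq.mul_zero_left (progDeriv_aciEq_zero_of_testHat dt htt p) g) (.zero _)
        simp only [progDeriv]
        split_ifs with hN
        · obtain ⟨g', hg', h4⟩ := hg2 hN p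
          exact .add h0 ((k2 h4 hg').epsHat_mul t)
        · exact h0
  · intro Z
    refine (Finset.card_union_le _ _).trans (Nat.add_le_add ((Finset.card_union_le _ _).trans
      (Nat.add_le_add (Finset.card_image_le.trans (hSn Z)) (hSn' Z))) ?_)
    refine Finset.card_biUnion_le_card_mul _ _ _ fun N _ => Finset.card_image_le.trans ?_
    rw [Finset.card_product]
    exact Nat.mul_le_mul (hTn Z N) (hSn' N)

/-- The generators are `s · e*` and `t · (s · e*)`, where the source `N` of `s` does not contain
`X`. A test prefix first arises in front of a derivative of `e` at a literal with base in `X`, whose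
source lacks that base, and sources only shrink under further literals. This condition keeps the
prefixes from nesting: a second one would be the test part of a member `N → X` of the system, which
is null. -/
theorem HasSystem.star {C n : ℕ}
    (hC : ∀ (n : ℕ) (S : Finset B → Finset (Expr P B)) (M : Finset B), IsClosedSystem S M →
      (∀ Z, (S Z).card ≤ n) → ∃ T : Finset B → Finset B → Finset (Expr P B), IsClosedTests T ∧
        (∀ Z, ∀ s ∈ S Z, ∀ b ∈ M, ∃ t ∈ T (Z.erase b) (M.erase b), AciEq (testHat s) t) ∧
        ∀ Z N, (T Z N).card ≤ C * n) {e : Expr P B} {X : Finset B}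
    (he : HasSystem n e X X) :
    HasSystem (2 ^ (n + n + Fintype.card (Finset B) * (C * n * n)) + 1) (.star e) X X := by
  obtain ⟨S, hS, heS, hSn⟩ := he
  obtain ⟨T, hT, hST, hTn⟩ := hC n S X hS hSn
  obtain ⟨de, he1, he2⟩ := hS X e heS
  set K : Finset B → Finset (Expr P B) := fun Z => (S Z).image (Expr.mul · (.star e)) ∪
    (Finset.univ.filter fun N => ¬ X ⊆ N).biUnion fun N =>
      (T Z N ×ˢ S N).image fun q => Expr.mul q.1 (.mul q.2 (.star e)) with hK
  have k1 : ∀ {Z : Finset B} {a s : Expr P B}, AciEq a s → s ∈ S Z →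
      InSpan (K Z) (.mul a (.star e)) := by
    intro Z a s h hs
    refine .of_mem (.mul h (.refl _)) ?_
    simp only [hK, Finset.mem_union, Finset.mem_image]
    exact .inl ⟨s, hs, rfl⟩
  have k3 : ∀ {Z N : Finset B} {a t a' s : Expr P B}, ¬ X ⊆ N → AciEq a t → t ∈ T Z N →
      AciEq a' s → s ∈ S N → InSpan (K Z) (.mul a (.mul a' (.star e))) := by
    intro Z N a t a' s hN h ht h' hs
    refine .of_mem (.mul h (.mul h' (.refl _))) ?_
    simp only [hK, Finset.mem_union, Finset.mem_biUnion, Finset.mem_image, Finset.mem_product,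
      Finset.mem_filter]
    exact .inr ⟨N, ⟨Finset.mem_univ _, hN⟩, (t, s), ⟨ht, hs⟩, rfl⟩
  have g1 : ∀ Z, ∀ s ∈ S Z, HasDerivsIn (fun Z => spanFinset (K Z)) X Z (.mul s (.star e)) := by
    intro Z s hs
    obtain ⟨d, h1, h2⟩ := hS Z s hs
    refine hasDerivsIn_span (.mul d (.star de)) (fun l hl => ?_) (fun hZ p => ?_)
    · obtain ⟨s', hs', h⟩ := h1 l hl
      simp only [litDeriv]
      split_ifs with hM
      · obtain ⟨t, ht, h3⟩ := hST Z s hs l.1 hM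
        obtain ⟨g, hg, h4⟩ := he1 l hM
        exact .add (k1 h hs') (k3 (fun hc => by simpa using hc hM) h3 ht h4 hg)
      · exact k1 h hs'
    · obtain ⟨s', hs', h⟩ := h2 hZ p
      simp only [progDeriv]
      split_ifs with hM
      · obtain ⟨g, hg, h4⟩ := he2 hM p
        exact .add (k1 h hs') ((k1 h4 hg).epsHat_mul s)
      · exact k1 h hs'
  refine hasSystem_of_generators (K := K) ?_ ?_ ?_
  · intro Z k hk
    simp only [hK, Finset.mem_union, Finset.mem_biUnion, Finset.mem_image,
      Finset.mem_product, Finset.mem_filter] at hk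
    rcases hk with ⟨s, hs, rfl⟩ | ⟨N, ⟨-, hXN⟩, ⟨t, g⟩, ⟨ht, hg⟩, rfl⟩
    · exact g1 Z s hs
    · obtain ⟨htt, dt, ht1, ht2⟩ := hT Z N t ht
      obtain ⟨dg, hg1, hg2⟩ := hS N g hg
      refine hasDerivsIn_span (.mul dt (.mul dg (.star de))) (fun l hl => ?_) (fun hZ p => ?_)
      · obtain ⟨t', ht', h⟩ := ht1 l hl
        have h0 := k3 hXN h ht' (.refl g) hg
        rw [litDeriv]
        by_cases hN : l.1 ∈ N
        · rw [if_pos hN]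
          obtain ⟨t'', ht'', h3⟩ := ht2 l.1 hN
          obtain ⟨g', hg', h4⟩ := hg1 l hN
          have h5 : AciEq (testHat t) t'' := by rw [htt]; exact h3
          have h6 : ¬ X ⊆ N.erase l.1 := fun hc => hXN (hc.trans (Finset.erase_subset _ _))
          refine .add h0 (.of_aciEq (.mul (.refl _) ?_) (k3 h6 h5 ht'' h4 hg'))
          -- The inner product rule would add another test prefix `testHat g`; it is null, because
          -- `g` would have to introduce `b` without a program.
          obtain ⟨b, hbX, hbN⟩ := Finset.not_subset.1 hXN
          rw [litDeriv]
          split_ifs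
          · exact .add_zero_right (.refl _)
              (.mul_zero_left (dg.isNull_testHat hbX hbN).aciEq_zero _)
          · exact .refl _
        · rw [if_neg hN]
          exact h0
      · have h0 : InSpan (K Finset.univ) (.mul (progDeriv p dt) (.mul g (.star e))) :=
          .of_aciEq (AciEq.mul_zero_left (progDeriv_aciEq_zero_of_testHat dt htt p) _) (.zero _)
        rw [progDeriv]
        by_cases hN : N = ∅
        · rw [if_pos hN]
          obtain ⟨g', hg', h4⟩ := hg2 hN p
          have hX : X ≠ ∅ := by
            rintro rfl
            exact hXN (Finset.empty_subset _)
          refine .add h0 (InSpan.epsHat_mul ?_ t)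
          rw [progDeriv, if_neg hX]
          exact k1 h4 hg'
        · rw [if_neg hN]
          exact h0
  · refine hasDerivsIn_span (.star de) (fun l hl => ?_) (fun hZ p => ?_)
    · obtain ⟨s, hs, h⟩ := he1 l hl
      exact k1 h hs
    · obtain ⟨s, hs, h⟩ := he2 hZ p
      exact k1 h hs
  · intro Z
    -- One summand `n` is slack; the bound has the shape of the one for products, so that both fit
    -- the recursion of `derivBound`.
    rw [Nat.add_assoc]
    refine (Finset.card_union_le _ _).trans (Nat.add_le_add
      (Finset.card_image_le.trans (hSn Z)) ((?_ : _ ≤ _).trans (Nat.le_add_left _ _)))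
    refine (Finset.card_biUnion_le_card_mul _ _ (C * n * n) fun N _ =>
      Finset.card_image_le.trans ?_).trans (Nat.mul_le_mul_right _ (Finset.card_le_univ _))
    rw [Finset.card_product]
    exact Nat.mul_le_mul (hTn Z N) (hSn N)

/-- A bound for the number of derivatives of an expression with a given code. -/
def derivBound (c : ℕ) : ℕ → ℕ
  | 0 => 3
  | n + 1 => 2 ^ (derivBound c n + derivBound c n + c * (derivBound c n * derivBound c n)) + 1

theorem derivBound_mono (c : ℕ) : Monotone (derivBound c) := by
  refine monotone_nat_of_le_succ fun n => ?_
  rw [derivBound]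
  have h := (Nat.lt_two_pow_self (n := derivBound c n)).le
  have h' : 2 ^ derivBound c n ≤ 2 ^ (derivBound c n + derivBound c n +
    c * (derivBound c n * derivBound c n)) := Nat.pow_le_pow_right (by norm_num) (by omega)
  omega

omit [Fintype B] [DecidableEq B] [DecidableEq (Expr P B)] in
theorem code_lt_add (ν : P → ℕ) (β : B → ℕ) (e f : Expr P B) :
    code ν β e < code ν β (.add e f) ∧ code ν β f < code ν β (.add e f) := by
  have h1 := Nat.left_le_pair (code ν β e) (code ν β f)
  have h2 := Nat.right_le_pair (code ν β e) (code ν β f)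
  simp only [code]
  omega

omit [Fintype B] [DecidableEq B] [DecidableEq (Expr P B)] in
theorem code_lt_mul (ν : P → ℕ) (β : B → ℕ) (e f : Expr P B) :
    code ν β e < code ν β (.mul e f) ∧ code ν β f < code ν β (.mul e f) := by
  have h1 := Nat.left_le_pair (code ν β e) (code ν β f)
  have h2 := Nat.right_le_pair (code ν β e) (code ν β f)
  simp only [code]
  omega

omit [Fintype B] [DecidableEq B] [DecidableEq (Expr P B)] in
theorem code_lt_star (ν : P → ℕ) (β : B → ℕ) (e : Expr P B) :
    code ν β e < code ν β (.star e) := by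
  simp only [code]
  omega

/-- The code serves merely as a size: subexpressions have smaller codes, so monotonicity of
`derivBound` lets one recursion step pay for each constructor. The constant is independent of the
expression, its type and the numberings, which makes the bound computable from the code. -/
theorem exists_hasSystem (P B : Type*) [Fintype B] [DecidableEq B] [DecidableEq (Expr P B)] :
    ∃ c : ℕ, ∀ (ν : P → ℕ) (β : B → ℕ) (e : Expr P B) (X Y : Finset B), TypeDeriv e X Y →
      HasSystem (derivBound c (code ν β e)) e X Y := by
  obtain ⟨C, hC⟩ := exists_isClosedTests P B
  refine ⟨Fintype.card (Finset B) * C, fun ν β e X Y d => ?_⟩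
  have h3 : ∀ n, 3 ≤ derivBound (Fintype.card (Finset B) * C) n :=
    fun n => derivBound_mono _ (Nat.zero_le n)
  have step : ∀ {m n : ℕ} {e : Expr P B} {X Y : Finset B}, m < n →
      HasSystem (2 ^ (derivBound (Fintype.card (Finset B) * C) (n - 1) +
        derivBound (Fintype.card (Finset B) * C) (n - 1) + Fintype.card (Finset B) *
          (C * derivBound (Fintype.card (Finset B) * C) (n - 1) *
            derivBound (Fintype.card (Finset B) * C) (n - 1))) + 1) e X Y →
      HasSystem (derivBound (Fintype.card (Finset B) * C) n) e X Y := by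
    intro m n e X Y hmn h
    obtain ⟨k, rfl⟩ : ∃ k, n = k + 1 := ⟨n - 1, by omega⟩
    refine h.mono (le_of_eq ?_)
    rw [derivBound, Nat.add_sub_cancel]
    congr 2
    ring
  have weak : ∀ {m n : ℕ} {e : Expr P B} {X Y : Finset B}, m < n →
      HasSystem (derivBound (Fintype.card (Finset B) * C) m) e X Y →
      HasSystem (derivBound (Fintype.card (Finset B) * C) (n - 1)) e X Y :=
    fun hmn h => h.mono (derivBound_mono _ (by omega))
  induction d with
  | zero X Y => exact (hasSystem_of_constant (.zero X Y)
      (fun _ _ => .inl rfl) (fun _ _ => .inl rfl)).mono (h3 _)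
  | one X => exact (hasSystem_of_constant (.one X)
      (fun _ _ => .inl rfl) (fun _ _ => .inl rfl)).mono (h3 _)
  | prog p =>
    refine (hasSystem_of_constant (.prog p) (fun _ _ => .inl rfl)
      (fun _ q => ?_)).mono (h3 _)
    simp only [progDeriv]
    split_ifs <;> simp
  | lit l X =>
    refine (hasSystem_of_constant (.lit l X) (fun l' _ => ?_)
      (fun h => by simp at h)).mono (h3 _)
    simp only [litDeriv]
    split_ifs with h
    · exact .inr ⟨rfl, by rw [h, Finset.erase_insert_eq_erase]⟩
    · exact .inl rfl
  | @add e f X Y d d' ih ih' =>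
    obtain ⟨h1, h2⟩ := code_lt_add ν β e f
    exact step h1 (((weak h1 ih).add (weak h2 ih')).mono (Nat.succ_le_succ
      (Nat.pow_le_pow_right (by norm_num) (Nat.le_add_right _ _))))
  | @mul e f X Z Y d d' ih ih' =>
    obtain ⟨h1, h2⟩ := code_lt_mul ν β e f
    exact step h1 (HasSystem.mul hC (weak h1 ih) (weak h2 ih'))
  | @star e X d ih =>
    have h1 := code_lt_star ν β e
    exact step h1 (HasSystem.star hC (weak h1 ih))

end Existence

/-! ### Bisimulations and bounded agreement -/

section Bisimulation

variable {P B : Type*} [Fintype B] [DecidableEq B]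

/-- While the source `X` is nonempty, the literal of `α` at some base in `X` is read, which shrinks
`X` and leaves the guarded string alone. At `X = ∅` either the string is exhausted and `epsHat`
decides, or its first program is read and the source becomes everything again. -/
theorem IsSyntacticBisimulation.guarded_iff {R : Finset B → Expr P B → Expr P B → Prop}
    {A : Finset B} {e₁ e₂ : Expr P B} (hR : IsSyntacticBisimulation R A e₁ e₂)
    (u : List (P × (B → Bool))) : ∀ (X : Finset B) (e f : Expr P B), R X e f →
      ∀ α, guarded e α u ↔ guarded f α u := by
  induction u with
  | nil =>
    intro X
    induction X using Finset.strongInduction with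
    | H X ih =>
      intro e f h α
      obtain ⟨⟨d⟩, ⟨d'⟩⟩ := hR.typed X e f h
      rcases X.eq_empty_or_nonempty with rfl | ⟨b, hb⟩
      · rw [← epsHat_eq_one_iff d, ← epsHat_eq_one_iff d', hR.eps_eq e f h]
      · obtain ⟨e', f', he, hf, h'⟩ := hR.lit_step X e f h (b, α b) hb d d'
        rw [← guarded_litDeriv_iff d (b, α b) rfl hb, ← guarded_litDeriv_iff d' (b, α b) rfl hb,
          he.guarded_eq, hf.guarded_eq]
        exact ih _ (Finset.erase_ssubset hb) _ _ h' α
  | cons x u ihu =>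
    intro X
    induction X using Finset.strongInduction with
    | H X ih =>
      intro e f h α
      obtain ⟨⟨d⟩, ⟨d'⟩⟩ := hR.typed X e f h
      rcases X.eq_empty_or_nonempty with rfl | ⟨b, hb⟩
      · obtain ⟨e', f', he, hf, h'⟩ := hR.prog_step e f h x.1 d d'
        rw [← guarded_progDeriv_iff d, ← guarded_progDeriv_iff d', he.guarded_eq, hf.guarded_eq]
        exact ihu _ _ _ h' _
      · obtain ⟨e', f', he, hf, h'⟩ := hR.lit_step X e f h (b, α b) hb d d'
        rw [← guarded_litDeriv_iff d (b, α b) rfl hb, ← guarded_litDeriv_iff d' (b, α b) rfl hb,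
          he.guarded_eq, hf.guarded_eq]
        exact ih _ (Finset.erase_ssubset hb) _ _ h' α

/-- A derivative at a literal does not depend on the value of its primitive test. -/
theorem guarded_of_aciEq_litDeriv {e s : Expr P B} {X : Finset B} (d : TypeDeriv e X ∅)
    {l : Literal B} (hl : l.1 ∈ X) (h : AciEq (litDeriv l d) s) (ds : TypeDeriv s (X.erase l.1) ∅)
    (α : B → Bool) (u : List (P × (B → Bool))) :
    guarded s α u ↔ guarded e (Function.update α l.1 l.2) u := by
  rw [← guarded_litDeriv_iff d l (by simp) hl, h.guarded_eq]
  have key : ∀ b ∈ X.erase l.1, α b = Function.update α l.1 l.2 b := fun b hb => by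
    rw [Function.update_of_ne (Finset.ne_of_mem_erase hb)]
  exact ⟨ds.isTyped.congr_first _ _ _ key,
    ds.isTyped.congr_first _ _ _ fun b hb => (key b hb).symm⟩

theorem exists_finite_bisimulation {A : Finset B} {e₁ e₂ : Expr P B}
    {S₁ S₂ : Finset B → Finset (Expr P B)} (h₁ : IsClosedSystem S₁ ∅) (h₂ : IsClosedSystem S₂ ∅)
    (he₁ : e₁ ∈ S₁ A) (he₂ : e₂ ∈ S₂ A) (h : guarded e₁ = guarded e₂) :
    ∃ R : Finset B → Expr P B → Expr P B → Prop,
      IsSyntacticBisimulation R A e₁ e₂ ∧ IsFiniteFamily R := by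
  -- Members of the two systems at the same source are related if their guarded languages agree. The
  -- systems provide suitable derivatives for one derivation each; uniqueness up to `AciEq` extends
  -- this to all derivations.
  refine ⟨fun X e f => e ∈ S₁ X ∧ f ∈ S₂ X ∧ guarded e = guarded f, ⟨?_, ⟨he₁, he₂, h⟩, ?_, ?_, ?_⟩,
    fun X => ((S₁ X) ×ˢ (S₂ X)).finite_toSet.subset fun q hq => ?_⟩
  · rintro X e f ⟨he, hf, -⟩
    obtain ⟨d, -⟩ := h₁ X e he
    obtain ⟨d', -⟩ := h₂ X f hf
    exact ⟨⟨d⟩, ⟨d'⟩⟩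
  · rintro e f ⟨he, hf, h⟩
    obtain ⟨d, -⟩ := h₁ ∅ e he
    obtain ⟨d', -⟩ := h₂ ∅ f hf
    have : epsHat e = .one ↔ epsHat f = .one := by
      rw [epsHat_eq_one_iff d fun _ => true, epsHat_eq_one_iff d' fun _ => true, h]
    rcases epsHat_eq_zero_or_one e with h1 | h1 <;>
      rcases epsHat_eq_zero_or_one f with h2 | h2 <;> simp_all
  · rintro e f ⟨he, hf, h⟩ p d d'
    obtain ⟨d₁, -, h1⟩ := h₁ ∅ e he
    obtain ⟨d₂, -, h2⟩ := h₂ ∅ f hf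
    obtain ⟨s, hs, h1⟩ := h1 rfl p
    obtain ⟨t, ht, h2⟩ := h2 rfl p
    refine ⟨s, t, (progDeriv_unique p d d₁ rfl).trans h1, (progDeriv_unique p d' d₂ rfl).trans h2,
      hs, ht, ?_⟩
    rw [← h1.guarded_eq, ← h2.guarded_eq]
    funext α u
    rw [guarded_progDeriv_iff d₁ p fun _ => true, guarded_progDeriv_iff d₂ p fun _ => true, h]
  · rintro X e f ⟨he, hf, h⟩ l hl d d'
    obtain ⟨d₁, h1, -⟩ := h₁ X e he
    obtain ⟨d₂, h2, -⟩ := h₂ X f hf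
    obtain ⟨s, hs, h1⟩ := h1 l hl
    obtain ⟨t, ht, h2⟩ := h2 l hl
    refine ⟨s, t, (litDeriv_unique l d d₁ rfl).trans h1, (litDeriv_unique l d' d₂ rfl).trans h2,
      hs, ht, ?_⟩
    obtain ⟨ds, -⟩ := h₁ _ s hs
    obtain ⟨dt, -⟩ := h₂ _ t ht
    funext α u
    rw [guarded_of_aciEq_litDeriv d₁ hl h1 ds, guarded_of_aciEq_litDeriv d₂ hl h2 dt, h]
  · exact Finset.mem_coe.2 (Finset.mem_product.2 ⟨hq.1, hq.2.1⟩)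

/-- The expressions agree on the guarded strings that are spelled in `n` steps. -/
def AgreeUpTo (n : ℕ) (Z : Finset B) (e f : Expr P B) : Prop :=
  ∀ α u, Z.card + (Fintype.card B + 1) * u.length ≤ n → (guarded e α u ↔ guarded f α u)

/-- The weight in `AgreeUpTo` drops by exactly one with each derivative: a literal removes one base
from the source, and a program trades its weight `Fintype.card B + 1` for the `Fintype.card B` bases
of the new source. An implication between two levels of agreement is thus inherited by the next
levels. -/
theorem agreeUpTo_succ {S₁ S₂ : Finset B → Finset (Expr P B)} (h₁ : IsClosedSystem S₁ ∅)
    (h₂ : IsClosedSystem S₂ ∅) {n m : ℕ}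
    (h : ∀ Z, ∀ e ∈ S₁ Z, ∀ f ∈ S₂ Z, AgreeUpTo n Z e f → AgreeUpTo m Z e f)
    {Z : Finset B} {e f : Expr P B} (he : e ∈ S₁ Z) (hf : f ∈ S₂ Z) (hn : AgreeUpTo (n + 1) Z e f) :
    AgreeUpTo (m + 1) Z e f := by
  intro α u hu
  obtain ⟨d₁, hl1, hp1⟩ := h₁ Z e he
  obtain ⟨d₂, hl2, hp2⟩ := h₂ Z f hf
  rcases Z.eq_empty_or_nonempty with rfl | ⟨b, hb⟩
  · rcases u with _ | ⟨x, u⟩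
    · exact hn α [] (by simp)
    · obtain ⟨s, hs, h1⟩ := hp1 rfl x.1
      obtain ⟨t, ht, h2⟩ := hp2 rfl x.1
      have key : ∀ α v, guarded s α v ↔ guarded e α ((x.1, α) :: v) := fun α v => by
        rw [← guarded_progDeriv_iff d₁ x.1 α, h1.guarded_eq]
      have key' : ∀ α v, guarded t α v ↔ guarded f α ((x.1, α) :: v) := fun α v => by
        rw [← guarded_progDeriv_iff d₂ x.1 α, h2.guarded_eq]
      rw [← guarded_progDeriv_iff d₁, ← guarded_progDeriv_iff d₂, h1.guarded_eq, h2.guarded_eq]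
      refine h _ s hs t ht (fun α v hv => ?_) _ _ ?_
      · rw [key, key']
        refine hn _ _ ?_
        simp only [Finset.card_univ, Finset.card_empty, List.length_cons, mul_add] at hv ⊢
        omega
      · simp only [Finset.card_univ, Finset.card_empty, List.length_cons, mul_add] at hu ⊢
        omega
  · have hc := Finset.card_erase_add_one hb
    obtain ⟨s, hs, h1⟩ := hl1 (b, α b) hb
    obtain ⟨t, ht, h2⟩ := hl2 (b, α b) hb
    obtain ⟨ds, -⟩ := h₁ _ s hs
    obtain ⟨dt, -⟩ := h₂ _ t ht
    rw [← guarded_litDeriv_iff d₁ (b, α b) rfl hb, ← guarded_litDeriv_iff d₂ (b, α b) rfl hb,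
      h1.guarded_eq, h2.guarded_eq]
    refine h _ s hs t ht (fun α' v hv => ?_) _ _ ?_
    · rw [guarded_of_aciEq_litDeriv d₁ hb h1 ds, guarded_of_aciEq_litDeriv d₂ hb h2 dt]
      refine hn _ _ ?_
      dsimp only at hv
      omega
    · dsimp only
      omega

/-- This is Moore's argument. The sets `E n` of pairs that agree up to `n` decrease, and `E 0` has
at most `N` elements, so two consecutive ones coincide at some `k ≤ N`. By `agreeUpTo_succ` the
chain is constant from there on. Agreement up to weight `k` involves only strings of length at most
`N`, as a step weighs at least one. -/
theorem guarded_eq_of_agree {A : Finset B} {e₁ e₂ : Expr P B} {n₁ n₂ : ℕ}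
    (h₁ : HasSystem n₁ e₁ A ∅) (h₂ : HasSystem n₂ e₂ A ∅)
    (h : ∀ α u, u.length ≤ Fintype.card (Finset B) * (n₁ * n₂) →
      (guarded e₁ α u ↔ guarded e₂ α u)) : guarded e₁ = guarded e₂ := by
  classical
  obtain ⟨S₁, h₁, he₁, hn₁⟩ := h₁
  obtain ⟨S₂, h₂, he₂, hn₂⟩ := h₂
  set N := Fintype.card (Finset B) * (n₁ * n₂) with hN
  let E : ℕ → Finset (Σ _ : Finset B, Expr P B × Expr P B) := fun n =>
    (Finset.univ.sigma fun Z => S₁ Z ×ˢ S₂ Z).filter fun q => AgreeUpTo n q.1 q.2.1 q.2.2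
  have hmem : ∀ n Z e f, (⟨Z, e, f⟩ : Σ _ : Finset B, Expr P B × Expr P B) ∈ E n ↔
      (e ∈ S₁ Z ∧ f ∈ S₂ Z) ∧ AgreeUpTo n Z e f := by
    intro n Z e f
    simp [E]
  have hanti : ∀ n, E (n + 1) ⊆ E n := by
    rintro n ⟨Z, e, f⟩ hq
    rw [hmem] at hq ⊢
    exact ⟨hq.1, fun α u hu => hq.2 α u (by omega)⟩
  have hcard : (E 0).card ≤ N := by
    refine (Finset.card_filter_le _ _).trans ?_
    rw [Finset.card_sigma]
    refine (Finset.sum_le_card_nsmul _ _ (n₁ * n₂) fun Z _ => ?_).trans_eq (by simp [hN])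
    rw [Finset.card_product]
    exact Nat.mul_le_mul (hn₁ Z) (hn₂ Z)
  have hstep : ∀ n m, E n ⊆ E m → E (n + 1) ⊆ E (m + 1) := by
    rintro n m hE ⟨Z, e, f⟩ hq
    rw [hmem] at hq ⊢
    refine ⟨hq.1, agreeUpTo_succ h₁ h₂ (fun Z e he f hf ha => ?_) hq.1.1 hq.1.2 hq.2⟩
    exact ((hmem _ _ _ _).1 (hE ((hmem _ _ _ _).2 ⟨⟨he, hf⟩, ha⟩))).2
  obtain ⟨k, hkN, hk⟩ : ∃ k ≤ N, E k ⊆ E (k + 1) := by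
    by_contra! hc
    have key : ∀ k ≤ N + 1, (E k).card + k ≤ N := by
      intro k
      induction k with
      | zero => exact fun _ => hcard
      | succ k ih =>
        intro hk
        have h1 := ih (by omega)
        have h2 : (E (k + 1)).card < (E k).card :=
          Finset.card_lt_card ⟨hanti k, hc k (by omega)⟩
        omega
    have := key (N + 1) le_rfl
    omega
  have hall : ∀ j, E k ⊆ E (k + j) := by
    intro j
    induction j with
    | zero => exact subset_rfl
    | succ j ih => exact hk.trans (hstep _ _ ih)
  have hek : (⟨A, e₁, e₂⟩ : Σ _ : Finset B, Expr P B × Expr P B) ∈ E k := by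
    refine (hmem _ _ _ _).2 ⟨⟨he₁, he₂⟩, fun α u hu => h α u ?_⟩
    have : u.length ≤ (Fintype.card B + 1) * u.length := Nat.le_mul_of_pos_left _ (by omega)
    omega
  funext α u
  refine propext (((hmem _ _ _ _).1 (hall (A.card + (Fintype.card B + 1) * u.length) hek)).2 α u ?_)
  omega

theorem lang_eq_iff_exists_bisimulation [Nonempty B] {A : Finset B} {e₁ e₂ : Expr P B}
    (h₁ : HasType e₁ A ∅) (h₂ : HasType e₂ A ∅) : lang e₁ = lang e₂ ↔
      ∃ R : Finset B → Expr P B → Expr P B → Prop,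
        IsSyntacticBisimulation R A e₁ e₂ ∧ IsFiniteFamily R := by
  classical
  rw [lang_eq_iff_guarded_eq h₁ h₂]
  constructor
  · intro h
    obtain ⟨c, hc⟩ := exists_hasSystem P B
    obtain ⟨d₁⟩ := h₁
    obtain ⟨d₂⟩ := h₂
    -- Only finiteness matters here, so any numberings will do, injective or not.
    obtain ⟨S₁, hS₁, he₁, -⟩ := hc (fun _ => 0) (fun _ => 0) e₁ A ∅ d₁
    obtain ⟨S₂, hS₂, he₂, -⟩ := hc (fun _ => 0) (fun _ => 0) e₂ A ∅ d₂
    exact exists_finite_bisimulation hS₁ hS₂ he₁ he₂ h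
  · rintro ⟨R, hR, -⟩
    funext α u
    exact propext (hR.guarded_iff u A e₁ e₂ hR.related α)

end Bisimulation

/-! ### Renaming programs by numbers -/

section Rename

variable {P Q B : Type*}

/-- Renaming of the primitive programs. -/
def Expr.rename (ν : P → Q) : Expr P B → Expr Q B
  | .zero => .zero
  | .one => .one
  | .prog p => .prog (ν p)
  | .lit l => .lit l
  | .add e f => .add (e.rename ν) (f.rename ν)
  | .mul e f => .mul (e.rename ν) (f.rename ν)
  | .star e => .star (e.rename ν)

theorem code_rename (ν : P → ℕ) (β : B → ℕ) (e : Expr P B) :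
    code id β (e.rename ν) = code ν β e := by
  induction e <;> simp_all [Expr.rename, code]

theorem HasType.rename [Fintype B] [DecidableEq B] (ν : P → Q) {e : Expr P B} {X Y : Finset B}
    (h : HasType e X Y) : HasType (e.rename ν) X Y := by
  obtain ⟨d⟩ := h
  induction d with
  | zero => exact ⟨.zero _ _⟩
  | one => exact ⟨.one _⟩
  | prog => exact ⟨.prog _⟩
  | lit => exact ⟨.lit _ _⟩
  | add _ _ ih ih' => exact ⟨.add ih.some ih'.some⟩
  | mul _ _ ih ih' => exact ⟨.mul ih.some ih'.some⟩
  | star _ ih => exact ⟨.star ih.some⟩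

theorem lastAtom_map (ν : P → Q) (α : B → Bool) (u : List (P × (B → Bool))) :
    lastAtom α (u.map (Prod.map ν id)) = lastAtom α u := by
  induction u generalizing α with
  | nil => rfl
  | cons x u ih => simp [ih]

theorem fusion_rename (ν : P → Q) {G H : (B → Bool) → List (P × (B → Bool)) → Prop}
    {G' H' : (B → Bool) → List (Q × (B → Bool)) → Prop}
    (hG : ∀ α v, G' α v ↔ ∃ u, v = u.map (Prod.map ν id) ∧ G α u)
    (hH : ∀ α v, H' α v ↔ ∃ u, v = u.map (Prod.map ν id) ∧ H α u) (α : B → Bool)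
    (v : List (Q × (B → Bool))) :
    fusion G' H' α v ↔ ∃ u, v = u.map (Prod.map ν id) ∧ fusion G H α u := by
  constructor
  · rintro ⟨v₁, v₂, rfl, h, h'⟩
    obtain ⟨u₁, rfl, h₁⟩ := (hG _ _).1 h
    obtain ⟨u₂, rfl, h₂⟩ := (hH _ _).1 h'
    rw [lastAtom_map] at h₂
    exact ⟨u₁ ++ u₂, by simp, u₁, u₂, rfl, h₁, h₂⟩
  · rintro ⟨_, rfl, u₁, u₂, rfl, h, h'⟩
    refine ⟨_, _, List.map_append, (hG _ _).2 ⟨u₁, rfl, h⟩, (hH _ _).2 ⟨u₂, rfl, ?_⟩⟩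
    rwa [lastAtom_map]

theorem guarded_rename (ν : P → Q) (e : Expr P B) (α : B → Bool) (v : List (Q × (B → Bool))) :
    guarded (e.rename ν) α v ↔ ∃ u, v = u.map (Prod.map ν id) ∧ guarded e α u := by
  induction e generalizing α v with
  | zero => simp [guarded, Expr.rename]
  | one => simp [guarded, Expr.rename]
  | prog p =>
    constructor
    · rintro ⟨α', rfl⟩
      exact ⟨[(p, α')], rfl, α', rfl⟩
    · rintro ⟨_, rfl, α', rfl⟩
      exact ⟨α', rfl⟩
  | lit l => simp [guarded, Expr.rename]
  | add e f ih ih' => simp only [guarded, Expr.rename, ih, ih', and_or_left, exists_or]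
  | mul e f ih ih' => exact fusion_rename ν ih ih' α v
  | star e ih =>
    have key : ∀ n α v, fusionPow (guarded (e.rename ν)) n α v ↔
        ∃ u, v = u.map (Prod.map ν id) ∧ fusionPow (guarded e) n α u := by
      intro n
      induction n with
      | zero => simp [fusionPow]
      | succ n ihn => exact fusion_rename ν ih ihn
    simp only [guarded, Expr.rename, key]
    constructor
    · rintro ⟨n, u, h, h'⟩
      exact ⟨u, h, n, h'⟩
    · rintro ⟨u, h, n, h'⟩
      exact ⟨n, u, h, h'⟩

theorem guarded_rename_eq_iff {ν : P → Q} (hν : Function.Injective ν) (e f : Expr P B) :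
    guarded (e.rename ν) = guarded (f.rename ν) ↔ guarded e = guarded f := by
  constructor
  · intro h
    have hinj : Function.Injective (List.map (Prod.map ν (id : (B → Bool) → B → Bool))) :=
      List.map_injective_iff.2 (hν.prodMap Function.injective_id)
    have key : ∀ e : Expr P B, ∀ α u, guarded e α u ↔
        guarded (e.rename ν) α (u.map (Prod.map ν id)) := by
      intro e α u
      rw [guarded_rename]
      constructor
      · exact fun h => ⟨u, rfl, h⟩
      · rintro ⟨u', hu, h⟩
        rwa [hinj hu]
    funext α u
    rw [key, key, h]
  · intro h
    funext α v
    rw [guarded_rename, guarded_rename, h]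

theorem fusionPow_forall_mem {G : (B → Bool) → List (P × (B → Bool)) → Prop}
    {p : P × (B → Bool) → Prop} (h : ∀ α u, G α u → ∀ x ∈ u, p x) (n : ℕ) :
    ∀ α u, fusionPow G n α u → ∀ x ∈ u, p x := by
  induction n with
  | zero => rintro α _ rfl; simp
  | succ n ih =>
    rintro α _ ⟨u₁, u₂, rfl, h1, h2⟩ x hx
    rcases List.mem_append.1 hx with hx | hx
    · exact h _ _ h1 x hx
    · exact ih _ _ h2 x hx

/-- This confines the comparison of two expressions to a finite alphabet that can be read off their
codes. -/
theorem lt_code_of_guarded (β : B → ℕ) {e : Expr ℕ B} {α : B → Bool}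
    {u : List (ℕ × (B → Bool))} (h : guarded e α u) : ∀ x ∈ u, x.1 < code id β e := by
  induction e generalizing α u with
  | zero => exact h.elim
  | one => obtain rfl : u = [] := h; simp
  | prog p =>
    obtain ⟨α', rfl⟩ := h
    simp only [List.mem_singleton, forall_eq, code, id]
    omega
  | lit l => obtain ⟨rfl, -⟩ := h; simp
  | add e f ih ih' =>
    intro x hx
    obtain ⟨h1, h2⟩ := code_lt_add id β e f
    rcases h with h | h
    · exact (ih h x hx).trans h1
    · exact (ih' h x hx).trans h2
  | mul e f ih ih' =>
    intro x hx
    obtain ⟨h1, h2⟩ := code_lt_mul id β e f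
    obtain ⟨u₁, u₂, rfl, h, h'⟩ := h
    rcases List.mem_append.1 hx with hx | hx
    · exact (ih h x hx).trans h1
    · exact (ih' h' x hx).trans h2
  | star e ih =>
    intro x hx
    obtain ⟨n, h⟩ := h
    exact (fusionPow_forall_mem (p := fun x => x.1 < code id β e)
      (fun α u h => ih h) n α u h x hx).trans (code_lt_star id β e)

end Rename

/-! ### Evaluating codes on words -/

section Evaluation

variable {B : Type*}

/-- The composition of two finite relations. -/
def composeRel (R S : List (ℕ × ℕ)) : List (ℕ × ℕ) :=
  R.flatMap fun p => S.flatMap fun q => if p.2 = q.1 then [(p.1, q.2)] else []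

/-- The identity relation on the numbers below `n`. -/
def diagRel (n : ℕ) : List (ℕ × ℕ) := (List.range n).map fun i => (i, i)

/-- The union of the powers `R ^ i`, `i ≤ k`, of a relation on the numbers below `n`. -/
def starRel (n : ℕ) (R : List (ℕ × ℕ)) (k : ℕ) : List (ℕ × ℕ) :=
  Nat.rec (diagRel n) (fun _ S => diagRel n ++ composeRel R S) k

/-- The relation between positions of a word given by a primitive program. -/
def progRel {ι : Type*} (W : List (ℕ × ι)) (k : ℕ) : List (ℕ × ℕ) :=
  (List.range W.length).flatMap fun i =>
    if W[i + 1]?.map Prod.fst = some k then [(i, i + 1)] else []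

/-- The relation between positions of a word given by a literal; `sat a` lists the numbers of the
literals that hold at `a`. -/
def litRel {ι : Type*} (sat : ι → List ℕ) (W : List (ℕ × ι)) (k : ℕ) : List (ℕ × ℕ) :=
  (List.range W.length).flatMap fun i =>
    ((W[i]?.map fun x => sat x.2).getD []).flatMap fun a => if a = k then [(i, i)] else []

/-- The relation given by the expression with code `L.length`, from the relations given by the
expressions with smaller codes. -/
def nextRel {ι : Type*} (sat : ι → List ℕ) (W : List (ℕ × ι)) (L : List (List (ℕ × ℕ))) :
    List (ℕ × ℕ) :=
  -- From `2` on, the code is `5 * k + 2 + r`, where the remainder `r` tells the constructor and `k`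
  -- holds its arguments.
  if L.length = 0 then [] else if L.length = 1 then diagRel W.length else
  if (L.length - 2) % 5 = 0 then progRel W ((L.length - 2) / 5) else
  if (L.length - 2) % 5 = 1 then litRel sat W ((L.length - 2) / 5) else
  if (L.length - 2) % 5 = 2 then
    L.getD ((L.length - 2) / 5).unpair.1 [] ++ L.getD ((L.length - 2) / 5).unpair.2 [] else
  if (L.length - 2) % 5 = 3 then
    composeRel (L.getD ((L.length - 2) / 5).unpair.1 []) (L.getD ((L.length - 2) / 5).unpair.2 [])
  else starRel W.length (L.getD ((L.length - 2) / 5) []) W.length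

/-- The relations given by the expressions with codes below `n`. -/
def relTable {ι : Type*} (sat : ι → List ℕ) (W : List (ℕ × ι)) (n : ℕ) : List (List (ℕ × ℕ)) :=
  Nat.rec [] (fun _ L => L ++ [nextRel sat W L]) n

/-- The relation between positions of a word given by the expression with code `n`. -/
def evalRel {ι : Type*} (sat : ι → List ℕ) (W : List (ℕ × ι)) (n : ℕ) : List (ℕ × ℕ) :=
  nextRel sat W (relTable sat W n)

section Table

variable {ι : Type*} (sat : ι → List ℕ) (W : List (ℕ × ι))

theorem length_relTable (n : ℕ) : (relTable sat W n).length = n := by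
  induction n with
  | zero => rfl
  | succ n ih =>
    change (relTable sat W n ++ [nextRel sat W (relTable sat W n)]).length = n + 1
    simp [ih]

theorem relTable_getD {m n : ℕ} (h : m < n) :
    (relTable sat W n).getD m [] = evalRel sat W m := by
  induction n with
  | zero => omega
  | succ n ih =>
    change (relTable sat W n ++ [nextRel sat W (relTable sat W n)]).getD m [] = _
    rcases Nat.lt_succ_iff_lt_or_eq.1 h with h | rfl
    · rw [List.getD_append _ _ _ _ (by rwa [length_relTable]), ih h]
    · rw [List.getD_append_right _ _ _ _ (by rw [length_relTable]), length_relTable]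
      simp [evalRel]

theorem evalRel_zero : evalRel sat W 0 = [] := rfl

theorem evalRel_prog (k : ℕ) : evalRel sat W (5 * k + 2) = progRel W k := by
  have h1 : (5 * k + 2 - 2) % 5 = 0 := by omega
  have h2 : (5 * k + 2 - 2) / 5 = k := by omega
  simp [evalRel, nextRel, length_relTable]

theorem evalRel_lit (k : ℕ) : evalRel sat W (5 * k + 3) = litRel sat W k := by
  have h1 : (5 * k + 3 - 2) % 5 = 1 := by omega
  have h2 : (5 * k + 3 - 2) / 5 = k := by omega
  simp only [evalRel, nextRel, length_relTable, h1, h2]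
  simp

theorem evalRel_add (a b : ℕ) :
    evalRel sat W (5 * Nat.pair a b + 4) = evalRel sat W a ++ evalRel sat W b := by
  have h1 : (5 * Nat.pair a b + 4 - 2) % 5 = 2 := by omega
  have h2 : (5 * Nat.pair a b + 4 - 2) / 5 = Nat.pair a b := by omega
  have h3 := Nat.left_le_pair a b
  have h4 := Nat.right_le_pair a b
  rw [evalRel, nextRel, length_relTable, h1, h2, Nat.unpair_pair, relTable_getD _ _ (by omega),
    relTable_getD _ _ (by omega)]
  simp

theorem evalRel_mul (a b : ℕ) : evalRel sat W (5 * Nat.pair a b + 5) =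
    composeRel (evalRel sat W a) (evalRel sat W b) := by
  have h1 : (5 * Nat.pair a b + 5 - 2) % 5 = 3 := by omega
  have h2 : (5 * Nat.pair a b + 5 - 2) / 5 = Nat.pair a b := by omega
  have h3 := Nat.left_le_pair a b
  have h4 := Nat.right_le_pair a b
  rw [evalRel, nextRel, length_relTable, h1, h2, Nat.unpair_pair, relTable_getD _ _ (by omega),
    relTable_getD _ _ (by omega)]
  simp

theorem evalRel_star (a : ℕ) :
    evalRel sat W (5 * a + 6) = starRel W.length (evalRel sat W a) W.length := by
  have h1 : (5 * a + 6 - 2) % 5 = 4 := by omega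
  have h2 : (5 * a + 6 - 2) / 5 = a := by omega
  rw [evalRel, nextRel, length_relTable, h1, h2, relTable_getD (m := a) _ _ (by omega)]
  simp

end Table

/-- The guarded string spelled by `W` between the positions `i` and `j` belongs to `G`. -/
def HoldsBetween (W : List (ℕ × (B → Bool))) (G : (B → Bool) → List (ℕ × (B → Bool)) → Prop)
    (i j : ℕ) : Prop :=
  -- Only the atom of `x` is used: the program stored at position `i` leads into that position and
  -- does not belong to the string.
  ∃ x u v, W.drop i = x :: (u ++ v) ∧ j = i + u.length ∧ G x.2 u

theorem drop_length_eq_cons (x : ℕ × (B → Bool)) (u w : List (ℕ × (B → Bool))) :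
    ∃ y, (x :: (u ++ w)).drop u.length = y :: w ∧ y.2 = lastAtom x.2 u := by
  induction u generalizing x with
  | nil => exact ⟨x, rfl, rfl⟩
  | cons z u ih =>
    obtain ⟨y, h, h'⟩ := ih z
    exact ⟨y, by simpa using h, by simpa using h'⟩

theorem holdsBetween_fusion (W : List (ℕ × (B → Bool)))
    (G H : (B → Bool) → List (ℕ × (B → Bool)) → Prop) (i j : ℕ) :
    HoldsBetween W (fusion G H) i j ↔ ∃ k, HoldsBetween W G i k ∧ HoldsBetween W H k j := by
  constructor
  · rintro ⟨x, _, v, hW, rfl, u₁, u₂, rfl, h, h'⟩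
    obtain ⟨y, hy, hy'⟩ := drop_length_eq_cons x u₁ (u₂ ++ v)
    refine ⟨i + u₁.length, ⟨x, u₁, u₂ ++ v, by simpa using hW, rfl, h⟩,
      y, u₂, v, ?_, by simp [add_assoc], by rwa [hy']⟩
    rw [← List.drop_drop, hW, ← hy, List.append_assoc]
  · rintro ⟨_, ⟨x, u₁, v₁, hW, rfl, h⟩, y', u₂, v₂, hW', rfl, h'⟩
    obtain ⟨y, hy, hy'⟩ := drop_length_eq_cons x u₁ v₁
    rw [← List.drop_drop, hW, hy] at hW'
    obtain ⟨rfl, rfl⟩ := List.cons.inj hW'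
    exact ⟨x, u₁ ++ u₂, v₂, by simpa using hW, by simp [add_assoc],
      u₁, u₂, rfl, h, by rwa [← hy']⟩

/-- The finite relation `R` is the one that `G` induces between the positions of `W`. -/
def Represents (W : List (ℕ × (B → Bool))) (R : List (ℕ × ℕ))
    (G : (B → Bool) → List (ℕ × (B → Bool)) → Prop) : Prop :=
  ∀ i j, (i, j) ∈ R ↔ HoldsBetween W G i j

theorem represents_diagRel (W : List (ℕ × (B → Bool))) :
    Represents W (diagRel W.length) fun _ u => u = [] := by
  intro i j
  simp only [diagRel, List.mem_map, List.mem_range, Prod.mk.injEq]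
  constructor
  · rintro ⟨i, hi, rfl, rfl⟩
    exact ⟨W[i], [], W.drop (i + 1), List.drop_eq_getElem_cons hi, rfl, rfl⟩
  · rintro ⟨x, u, v, hW, rfl, rfl⟩
    refine ⟨i, ?_, rfl, rfl⟩
    by_contra h
    rw [List.drop_eq_nil_of_le (by omega)] at hW
    simp at hW

theorem Represents.compose {W : List (ℕ × (B → Bool))} {R S : List (ℕ × ℕ)}
    {G H : (B → Bool) → List (ℕ × (B → Bool)) → Prop} (hR : Represents W R G)
    (hS : Represents W S H) : Represents W (composeRel R S) (fusion G H) := by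
  intro i j
  rw [holdsBetween_fusion]
  simp only [composeRel, List.mem_flatMap, ← hR _ _, ← hS _ _]
  constructor
  · rintro ⟨⟨a, b⟩, hab, ⟨c, d⟩, hcd, h⟩
    split_ifs at h with hbc
    · simp only [List.mem_singleton, Prod.mk.injEq] at h
      dsimp only at hbc
      obtain ⟨rfl, rfl⟩ := h
      subst hbc
      exact ⟨b, hab, hcd⟩
    · simp at h
  · rintro ⟨k, h, h'⟩
    exact ⟨(i, k), h, (k, j), h', by simp⟩

theorem Represents.append {W : List (ℕ × (B → Bool))} {R S : List (ℕ × ℕ)}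
    {G H : (B → Bool) → List (ℕ × (B → Bool)) → Prop} (hR : Represents W R G)
    (hS : Represents W S H) : Represents W (R ++ S) fun α u => G α u ∨ H α u := by
  intro i j
  rw [List.mem_append, hR, hS]
  constructor
  · rintro (⟨x, u, v, h1, h2, h3⟩ | ⟨x, u, v, h1, h2, h3⟩)
    · exact ⟨x, u, v, h1, h2, .inl h3⟩
    · exact ⟨x, u, v, h1, h2, .inr h3⟩
  · rintro ⟨x, u, v, h1, h2, h3 | h3⟩
    · exact .inl ⟨x, u, v, h1, h2, h3⟩
    · exact .inr ⟨x, u, v, h1, h2, h3⟩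

theorem Represents.starRel {W : List (ℕ × (B → Bool))} {R : List (ℕ × ℕ)}
    {G : (B → Bool) → List (ℕ × (B → Bool)) → Prop} (hR : Represents W R G) (k : ℕ) :
    Represents W (starRel W.length R k) fun α u => ∃ n ≤ k, fusionPow G n α u := by
  induction k with
  | zero =>
    have : (fun α u => ∃ n ≤ 0, fusionPow G n α u) =
        fun (_ : B → Bool) (u : List (ℕ × (B → Bool))) => u = [] := by
      funext α u
      simp [fusionPow]
    rw [this]
    exact represents_diagRel W
  | succ k ih =>
    have : (fun α u => ∃ n ≤ k + 1, fusionPow G n α u) = fun α u => u = [] ∨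
        fusion G (fun α u => ∃ n ≤ k, fusionPow G n α u) α u := by
      funext α u
      refine propext ⟨?_, ?_⟩
      · rintro ⟨_ | n, hn, h⟩
        · exact .inl h
        · obtain ⟨u₁, u₂, rfl, h, h'⟩ := h
          exact .inr ⟨u₁, u₂, rfl, h, n, by omega, h'⟩
      · rintro (h | ⟨u₁, u₂, rfl, h, n, hn, h'⟩)
        · exact ⟨0, by omega, h⟩
        · exact ⟨n + 1, by omega, u₁, u₂, rfl, h, h'⟩
    rw [this]
    exact (represents_diagRel W).append (hR.compose ih)

/-- Factors without programs leave the atom unchanged and can be dropped; each of the others uses up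
at least one step. Hence `starRel` may stop after as many powers as the word has letters. -/
theorem exists_fusionPow_le_length {P : Type*} {G : (B → Bool) → List (P × (B → Bool)) → Prop}
    {n : ℕ} {α : B → Bool} {u : List (P × (B → Bool))} (h : fusionPow G n α u) :
    ∃ m ≤ u.length, fusionPow G m α u := by
  induction n generalizing α u with
  | zero => exact ⟨0, by omega, h⟩
  | succ n ih =>
    obtain ⟨u₁, u₂, rfl, h, h'⟩ := h
    obtain ⟨m, hm, h'⟩ := ih h'
    rcases u₁ with _ | ⟨x, u₁⟩
    · exact ⟨m, hm, h'⟩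
    · exact ⟨m + 1, by simp; omega, _, u₂, rfl, h, h'⟩

theorem represents_evalRel {sat : (B → Bool) → List ℕ} {β : B → ℕ}
    (hsat : ∀ (α : B → Bool) (l : Literal B), 2 * β l.1 + l.2.toNat ∈ sat α ↔ α l.1 = l.2)
    (W : List (ℕ × (B → Bool))) (e : Expr ℕ B) :
    Represents W (evalRel sat W (code id β e)) (guarded e) := by
  induction e with
  | zero =>
    intro i j
    simp [code, evalRel_zero, HoldsBetween, guarded]
  | one => exact represents_diagRel W
  | prog p =>
    intro i j
    have hW : W[i + 1]? = (W.drop i)[1]? := by rw [List.getElem?_drop]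
    rw [code, evalRel_prog, progRel, List.mem_flatMap]
    constructor
    · rintro ⟨a, ha, h⟩
      split_ifs at h with hp
      · simp only [List.mem_singleton, Prod.mk.injEq] at h
        obtain ⟨rfl, rfl⟩ := h
        rw [hW] at hp
        rcases hd : W.drop i with _ | ⟨x, _ | ⟨y, v⟩⟩
        · simp [hd] at hp
        · simp [hd] at hp
        · simp only [hd, List.getElem?_cons_succ, List.getElem?_cons_zero, Option.map_some,
            Option.some.injEq] at hp
          refine ⟨x, [y], v, hd, rfl, y.2, ?_⟩
          rw [← show y.1 = p from hp]
      · simp at h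
    · rintro ⟨x, u, v, hd, rfl, α', rfl⟩
      refine ⟨i, ?_, ?_⟩
      · rw [List.mem_range]
        by_contra h
        rw [List.drop_eq_nil_of_le (by omega)] at hd
        simp at hd
      · rw [hW, hd]
        simp
  | lit l =>
    intro i j
    have hW : W[i]? = (W.drop i)[0]? := by rw [List.getElem?_drop, add_zero]
    rw [code, evalRel_lit, litRel, List.mem_flatMap]
    constructor
    · rintro ⟨a, ha, h⟩
      obtain ⟨k, hk, h⟩ := List.mem_flatMap.1 h
      split_ifs at h with hp
      · simp only [List.mem_singleton, Prod.mk.injEq] at h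
        obtain ⟨rfl, rfl⟩ := h
        rw [hW] at hk
        rcases hd : W.drop j with _ | ⟨x, v⟩
        · simp [hd] at hk
        · simp only [hd, List.getElem?_cons_zero, Option.map_some, Option.getD_some, hp] at hk
          exact ⟨x, [], v, hd, rfl, rfl, (hsat _ _).1 hk⟩
      · simp at h
    · rintro ⟨x, u, v, hd, rfl, rfl, h⟩
      refine ⟨i, ?_, ?_⟩
      · rw [List.mem_range]
        by_contra h
        rw [List.drop_eq_nil_of_le (by omega)] at hd
        simp at hd
      · rw [hW, hd]
        refine List.mem_flatMap.2 ⟨_, ?_, by rw [if_pos rfl]; simp⟩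
        simpa using (hsat _ _).2 h
  | add e f ih ih' =>
    rw [code, evalRel_add]
    exact ih.append ih'
  | mul e f ih ih' =>
    rw [code, evalRel_mul]
    exact ih.compose ih'
  | star e ih =>
    rw [code, evalRel_star]
    intro i j
    rw [ih.starRel W.length i j]
    constructor
    · rintro ⟨x, u, v, h1, h2, n, -, h3⟩
      exact ⟨x, u, v, h1, h2, n, h3⟩
    · rintro ⟨x, u, v, h1, h2, n, h3⟩
      obtain ⟨m, hm, h3⟩ := exists_fusionPow_le_length h3
      refine ⟨x, u, v, h1, h2, m, hm.trans ?_, h3⟩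
      have := congrArg List.length h1
      simp only [List.length_drop, List.length_cons, List.length_append] at this
      omega

/-- All words of length at most `n` with letters in `L`. -/
def wordsUpTo {ι : Type*} (L : List ι) (n : ℕ) : List (List ι) :=
  Nat.rec [[]] (fun _ S => [] :: L.flatMap fun x => S.map fun w => x :: w) n

theorem mem_wordsUpTo {ι : Type*} {L : List ι} {n : ℕ} {w : List ι} (hn : w.length ≤ n)
    (h : ∀ x ∈ w, x ∈ L) : w ∈ wordsUpTo L n := by
  induction n generalizing w with
  | zero =>
    rw [List.length_eq_zero_iff.1 (Nat.le_zero.1 hn)]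
    exact List.mem_singleton_self _
  | succ n ih =>
    change w ∈ [] :: L.flatMap fun x => (wordsUpTo L n).map fun w => x :: w
    rcases w with _ | ⟨x, w⟩
    · simp
    · simp only [List.length_cons, Nat.add_le_add_iff_right] at hn
      have := ih hn fun y hy => h y (List.mem_cons_of_mem _ hy)
      simp [h x (by simp), this]

/-- Two expressions have the same guarded language if they agree on enough words. -/
theorem guarded_eq_iff_forall_words [Fintype B] [DecidableEq B] {sat : (B → Bool) → List ℕ}
    {β : B → ℕ}
    (hsat : ∀ (α : B → Bool) (l : Literal B), 2 * β l.1 + l.2.toNat ∈ sat α ↔ α l.1 = l.2)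
    {A : Finset B} {e f : Expr ℕ B} {n m : ℕ} (he : HasSystem n e A ∅) (hf : HasSystem m f A ∅)
    {L : List (ℕ × (B → Bool))}
    (hL : ∀ x : ℕ × (B → Bool), x.1 ≤ code id β e + code id β f → x ∈ L) :
    guarded e = guarded f ↔
      ∀ W ∈ wordsUpTo L (Fintype.card (Finset B) * (n * m) + 1),
        ((0, W.length - 1) ∈ evalRel sat W (code id β e) ↔
          (0, W.length - 1) ∈ evalRel sat W (code id β f)) := by
  constructor
  · intro h W _
    rw [represents_evalRel hsat W e, represents_evalRel hsat W f, h]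
  · intro h
    -- The guarded string `(α, u)` is presented as the word `(0, α) :: u`, whose leading program `0`
    -- is a dummy that is never read. This extra letter accounts for the `+ 1` in the length bound.
    have key : ∀ (e : Expr ℕ B) (α : B → Bool) (u : List (ℕ × (B → Bool))),
        (0, ((0, α) :: u).length - 1) ∈ evalRel sat ((0, α) :: u) (code id β e) ↔
          guarded e α u := by
      intro e α u
      rw [represents_evalRel hsat _ e]
      constructor
      · rintro ⟨x, w, v, h1, h2, h3⟩
        obtain ⟨rfl, rfl⟩ := List.cons.inj h1
        simp only [List.length_cons, List.length_append] at h2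
        obtain rfl := List.length_eq_zero_iff.1 (show v.length = 0 by omega)
        simpa using h3
      · intro h
        exact ⟨(0, α), u, [], by simp, by simp, h⟩
    refine guarded_eq_of_agree he hf fun α u hu => ?_
    by_cases hu' : ∀ x ∈ u, x.1 ≤ code id β e + code id β f
    · have := h ((0, α) :: u) (mem_wordsUpTo (by simpa using hu) fun x hx => ?_)
      · rwa [key, key] at this
      · rcases List.mem_cons.1 hx with rfl | hx
        · exact hL _ (Nat.zero_le _)
        · exact hL _ (hu' x hx)
    -- A program with a number beyond both codes occurs in neither expression, so both languages
    -- exclude the string.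
    · refine iff_of_false (fun h => hu' fun x hx => ?_) (fun h => hu' fun x hx => ?_)
      · have := lt_code_of_guarded β h x hx
        omega
      · have := lt_code_of_guarded β h x hx
        omega

end Evaluation

/-! ### Primitive recursiveness of the decision procedure -/

section Computability

variable {α ι : Type*} [Primcodable α] [Primcodable ι]

theorem primrec_composeRel : Primrec₂ composeRel := by
  have h : Primrec fun q : ((List (ℕ × ℕ) × List (ℕ × ℕ)) × (ℕ × ℕ)) × (ℕ × ℕ) =>
      if q.1.2.2 = q.2.1 then [(q.1.2.1, q.2.2)] else [] :=
    Primrec.ite (Primrec.eq.comp (Primrec.snd.comp (Primrec.snd.comp Primrec.fst))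
      (Primrec.fst.comp Primrec.snd)) (Primrec.list_cons.comp (Primrec.pair
        (Primrec.fst.comp (Primrec.snd.comp Primrec.fst)) (Primrec.snd.comp Primrec.snd))
        (Primrec.const [])) (Primrec.const [])
  exact Primrec.list_flatMap Primrec.fst
    (Primrec.list_flatMap (Primrec.snd.comp Primrec.fst) h.to₂).to₂

theorem primrec_diagRel : Primrec diagRel :=
  Primrec.list_map Primrec.list_range (Primrec.pair Primrec.snd Primrec.snd).to₂

theorem primrec_starRel {n k : α → ℕ} {R : α → List (ℕ × ℕ)} (hn : Primrec n) (hR : Primrec R)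
    (hk : Primrec k) : Primrec fun a => starRel (n a) (R a) (k a) :=
  Primrec.nat_rec' hk (primrec_diagRel.comp hn)
    (Primrec.list_append.comp (primrec_diagRel.comp (hn.comp Primrec.fst))
      (primrec_composeRel.comp (hR.comp Primrec.fst) (Primrec.snd.comp Primrec.snd))).to₂

theorem primrec_progRel {W : α → List (ℕ × ι)} {k : α → ℕ} (hW : Primrec W) (hk : Primrec k) :
    Primrec fun a => progRel (W a) (k a) := by
  refine Primrec.list_flatMap (Primrec.list_range.comp (Primrec.list_length.comp hW)) ?_
  have h : Primrec fun q : α × ℕ => (W q.1)[q.2 + 1]?.map Prod.fst :=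
    Primrec.option_map (Primrec.list_getElem?.comp (hW.comp Primrec.fst)
      (Primrec.succ.comp Primrec.snd)) (Primrec.fst.comp Primrec.snd).to₂
  exact (Primrec.ite (Primrec.eq.comp h (Primrec.option_some.comp (hk.comp Primrec.fst)))
    (Primrec.list_cons.comp (Primrec.pair Primrec.snd (Primrec.succ.comp Primrec.snd))
      (Primrec.const [])) (Primrec.const [])).to₂

theorem primrec_litRel {sat : ι → List ℕ} (hsat : Primrec sat) {W : α → List (ℕ × ι)} {k : α → ℕ}
    (hW : Primrec W) (hk : Primrec k) : Primrec fun a => litRel sat (W a) (k a) := by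
  refine Primrec.list_flatMap (Primrec.list_range.comp (Primrec.list_length.comp hW)) ?_
  have h : Primrec fun q : α × ℕ => ((W q.1)[q.2]?.map fun x => sat x.2).getD [] :=
    Primrec.option_getD.comp (Primrec.option_map (Primrec.list_getElem?.comp
      (hW.comp Primrec.fst) Primrec.snd)
      (hsat.comp (Primrec.snd.comp Primrec.snd)).to₂) (Primrec.const [])
  have h' : Primrec fun q : (α × ℕ) × ℕ => if q.2 = k q.1.1 then [(q.1.2, q.1.2)] else [] :=
    Primrec.ite (Primrec.eq.comp Primrec.snd (hk.comp (Primrec.fst.comp Primrec.fst)))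
      (Primrec.list_cons.comp (Primrec.pair (Primrec.snd.comp Primrec.fst)
        (Primrec.snd.comp Primrec.fst)) (Primrec.const [])) (Primrec.const [])
  exact (Primrec.list_flatMap h h'.to₂).to₂

theorem primrec_nextRel {sat : ι → List ℕ} (hsat : Primrec sat) : Primrec₂ (nextRel sat) := by
  have hW : Primrec fun q : List (ℕ × ι) × List (List (ℕ × ℕ)) => q.1 := Primrec.fst
  have hL : Primrec fun q : List (ℕ × ι) × List (List (ℕ × ℕ)) => q.2.length :=
    Primrec.list_length.comp Primrec.snd
  have hm := Primrec.nat_mod.comp (Primrec.nat_sub.comp hL (Primrec.const 2)) (Primrec.const 5)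
  have hd := Primrec.nat_div.comp (Primrec.nat_sub.comp hL (Primrec.const 2)) (Primrec.const 5)
  have hget : ∀ {f : List (ℕ × ι) × List (List (ℕ × ℕ)) → ℕ}, Primrec f →
      Primrec fun q : List (ℕ × ι) × List (List (ℕ × ℕ)) => q.2.getD (f q) [] :=
    fun hf => (Primrec.list_getD []).comp Primrec.snd hf
  have hget1 := hget (Primrec.fst.comp (Primrec.unpair.comp hd))
  have hget2 := hget (Primrec.snd.comp (Primrec.unpair.comp hd))
  have hlen := Primrec.list_length.comp hW
  have hif : ∀ {f : List (ℕ × ι) × List (List (ℕ × ℕ)) → ℕ} {c : ℕ}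
      {g h : List (ℕ × ι) × List (List (ℕ × ℕ)) → List (ℕ × ℕ)}, Primrec f → Primrec g →
      Primrec h → Primrec fun q => if f q = c then g q else h q :=
    fun hf hg hh => Primrec.ite (Primrec.eq.comp hf (Primrec.const _)) hg hh
  exact hif hL (Primrec.const []) <| hif hL (primrec_diagRel.comp hlen) <|
    hif hm (primrec_progRel hW hd) <| hif hm (primrec_litRel hsat hW hd) <|
    hif hm (Primrec.list_append.comp hget1 hget2) <|
    hif hm (primrec_composeRel.comp hget1 hget2) (primrec_starRel hlen (hget hd) hlen)

theorem primrec_evalRel {sat : ι → List ℕ} (hsat : Primrec sat) : Primrec₂ (evalRel sat) := by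
  have hstep : Primrec fun q : List (ℕ × ι) × (ℕ × List (List (ℕ × ℕ))) =>
      q.2.2 ++ [nextRel sat q.1 q.2.2] :=
    Primrec.list_append.comp (Primrec.snd.comp Primrec.snd)
      (Primrec.list_cons.comp ((primrec_nextRel hsat).comp Primrec.fst
        (Primrec.snd.comp Primrec.snd)) (Primrec.const []))
  have h : Primrec₂ (relTable sat) :=
    Primrec.nat_rec (f := fun _ => ([] : List (List (ℕ × ℕ))))
      (g := fun W q => q.2 ++ [nextRel sat W q.2]) (Primrec.const _) hstep.to₂
  exact (primrec_nextRel hsat).comp₂ Primrec₂.left h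

theorem primrec_wordsUpTo {L : α → List ι} {n : α → ℕ} (hL : Primrec L) (hn : Primrec n) :
    Primrec fun a => wordsUpTo (L a) (n a) := by
  have h : Primrec fun q : (α × (ℕ × List (List ι))) × ι => q.1.2.2.map fun w => q.2 :: w :=
    Primrec.list_map (Primrec.snd.comp (Primrec.snd.comp Primrec.fst))
      (Primrec.list_cons.comp (Primrec.snd.comp Primrec.fst) Primrec.snd).to₂
  have hstep : Primrec fun q : α × (ℕ × List (List ι)) =>
      [] :: (L q.1).flatMap fun x => q.2.2.map fun w => x :: w :=
    Primrec.list_cons.comp (Primrec.const []) (Primrec.list_flatMap (hL.comp Primrec.fst) h.to₂)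
  exact Primrec.nat_rec' hn (Primrec.const [[]]) hstep.to₂

theorem primrec_derivBound (c : ℕ) : Primrec (derivBound c) := by
  have hpow : Primrec₂ fun a b : ℕ => a ^ b := Primrec₂.unpaired'.1 Nat.Primrec.pow
  have h : Primrec₂ fun _ m : ℕ => 2 ^ (m + m + c * (m * m)) + 1 := by
    have hm : Primrec fun q : ℕ × ℕ => q.2 := Primrec.snd
    exact Primrec.succ.comp (hpow.comp (Primrec.const 2) (Primrec.nat_add.comp
      (Primrec.nat_add.comp hm hm) (Primrec.nat_mul.comp (Primrec.const c)
        (Primrec.nat_mul.comp hm hm))))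
  refine (Primrec.nat_rec₁ 3 h).of_eq fun n => ?_
  induction n with
  | zero => rfl
  | succ n ih =>
    rw [derivBound, ← ih]

theorem primrecPred_forall_words {sat : ι → List ℕ} (hsat : Primrec sat) {L : ℕ × ℕ → List (ℕ × ι)}
    {n : ℕ × ℕ → ℕ} (hL : Primrec L) (hn : Primrec n) :
    PrimrecPred fun c : ℕ × ℕ => ∀ W ∈ wordsUpTo (L c) (n c),
      ((0, W.length - 1) ∈ evalRel sat W c.1 ↔ (0, W.length - 1) ∈ evalRel sat W c.2) := by
  have hmem : ∀ {f : List (ℕ × ι) × (ℕ × ℕ) → ℕ}, Primrec f →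
      PrimrecPred fun q : List (ℕ × ι) × (ℕ × ℕ) =>
        (0, q.1.length - 1) ∈ evalRel sat q.1 (f q) := by
    intro f hf
    have h : PrimrecRel fun (R : List (ℕ × ℕ)) (b : ℕ × ℕ) => ∃ a ∈ R, a = b :=
      PrimrecRel.exists_mem_list Primrec.eq
    refine (h.comp ((primrec_evalRel hsat).comp Primrec.fst hf) (Primrec.pair (Primrec.const 0)
      (Primrec.pred.comp (Primrec.list_length.comp Primrec.fst)))).of_eq fun q => ?_
    simp
  have h1 := hmem (Primrec.fst.comp Primrec.snd)
  have h2 := hmem (Primrec.snd.comp Primrec.snd)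
  have h : PrimrecRel fun (W : List (ℕ × ι)) (c : ℕ × ℕ) =>
      ((0, W.length - 1) ∈ evalRel sat W c.1 ↔ (0, W.length - 1) ∈ evalRel sat W c.2) :=
    ((h1.and h2).or (h1.not.and h2.not)).of_eq fun q => iff_iff_and_or_not_and_not.symm
  exact (PrimrecRel.forall_mem_list h).comp (primrec_wordsUpTo hL hn) Primrec.id

end Computability

/-- Equivalence of mixed expressions of a common type `A → ∅` is decidable. -/
theorem exists_computable_decision {P B : Type*} [Fintype B] [DecidableEq B] [Nonempty B]
    {ν : P → ℕ} {β : B → ℕ} (hν : Function.Injective ν) (hβ : Function.Injective β) :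
    ∃ dec : ℕ × ℕ → Bool, Computable dec ∧
      ∀ (A : Finset B) (e₁ e₂ : Expr P B), HasType e₁ A ∅ → HasType e₂ A ∅ →
        (dec (code ν β e₁, code ν β e₂) = true ↔ lang e₁ = lang e₂) := by
  classical
  -- Atoms form a finite type, so any enumeration serves as a coding, and `sat` is primitive
  -- recursive simply because its domain is finite.
  let _ : Primcodable (B → Bool) := Primcodable.ofEquiv _ (Fintype.equivFin (B → Bool))
  let sat : (B → Bool) → List ℕ := fun α =>
    ((Finset.univ : Finset (Literal B)).filter fun l => α l.1 = l.2).toList.map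
      fun l => 2 * β l.1 + l.2.toNat
  have hcode : Function.Injective fun l : Literal B => 2 * β l.1 + l.2.toNat := by
    intro l l' h
    obtain ⟨b, s⟩ := l
    obtain ⟨b', s'⟩ := l'
    have h1 : β b = β b' ∧ s = s' := by
      cases s <;> cases s' <;> simp only [Bool.toNat_true, Bool.toNat_false] at h ⊢ <;> simp <;>
        omega
    exact Prod.ext (hβ h1.1) h1.2
  have hsat : ∀ (α : B → Bool) (l : Literal B),
      2 * β l.1 + l.2.toNat ∈ sat α ↔ α l.1 = l.2 := by
    intro α l
    rw [List.mem_map]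
    constructor
    · rintro ⟨l', hl', h⟩
      obtain rfl := hcode h
      simpa using hl'
    · exact fun h => ⟨l, by simpa using h, rfl⟩
  obtain ⟨c, hc⟩ := exists_hasSystem ℕ B
  let L : ℕ × ℕ → List (ℕ × (B → Bool)) := fun q =>
    (List.range (q.1 + q.2 + 1)).flatMap fun p =>
      (Finset.univ : Finset (B → Bool)).toList.map fun α => (p, α)
  let n : ℕ × ℕ → ℕ := fun q =>
    Fintype.card (Finset B) * (derivBound c q.1 * derivBound c q.2) + 1
  have hL : Primrec L := Primrec.list_flatMap (Primrec.list_range.comp (Primrec.succ.comp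
    (Primrec.nat_add.comp Primrec.fst Primrec.snd)))
    (Primrec.list_map (Primrec.const _) (Primrec.pair (Primrec.snd.comp Primrec.fst)
      Primrec.snd).to₂).to₂
  have hn : Primrec n := Primrec.succ.comp (Primrec.nat_mul.comp (Primrec.const _)
    (Primrec.nat_mul.comp ((primrec_derivBound c).comp Primrec.fst)
      ((primrec_derivBound c).comp Primrec.snd)))
  -- The procedure does not need the type `A`: both the alphabet `L` and the length bound `n` depend
  -- on the two codes alone.
  refine ⟨_, (primrecPred_forall_words (Primrec.dom_finite sat) hL hn).decide.to_comp,
    fun A e₁ e₂ h₁ h₂ => ?_⟩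
  have h₁' := h₁.rename ν
  have h₂' := h₂.rename ν
  rw [decide_eq_true_iff, lang_eq_iff_guarded_eq h₁ h₂, ← guarded_rename_eq_iff hν,
    ← code_rename ν β e₁, ← code_rename ν β e₂]
  refine (guarded_eq_iff_forall_words hsat (hc id β _ A ∅ h₁'.some) (hc id β _ A ∅ h₂'.some)
    fun x hx => ?_).symm
  simp only [L, List.mem_flatMap, List.mem_range, List.mem_map, Finset.mem_toList]
  exact ⟨x.1, Nat.lt_succ_of_le hx, x.2, Finset.mem_univ _, rfl⟩

end KatMixed

theorem mainTheorem5 {P B : Type*} [Fintype B] [DecidableEq B] [Nonempty B] :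
    (∀ (A : Finset B) (e₁ e₂ : KatMixed.Expr P B),
      KatMixed.HasType e₁ A ∅ → KatMixed.HasType e₂ A ∅ →
        (KatMixed.lang e₁ = KatMixed.lang e₂ ↔
          ∃ R : Finset B → KatMixed.Expr P B → KatMixed.Expr P B → Prop,
            KatMixed.IsSyntacticBisimulation R A e₁ e₂ ∧ KatMixed.IsFiniteFamily R)) ∧
    (∀ (ν : P → ℕ) (β : B → ℕ), Function.Injective ν → Function.Injective β →
      ∃ dec : ℕ × ℕ → Bool, Computable dec ∧
        ∀ (A : Finset B) (e₁ e₂ : KatMixed.Expr P B),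
          KatMixed.HasType e₁ A ∅ → KatMixed.HasType e₂ A ∅ →
            (dec (KatMixed.code ν β e₁, KatMixed.code ν β e₂) = true ↔
              KatMixed.lang e₁ = KatMixed.lang e₂)) :=
  ⟨fun _ _ _ h₁ h₂ => KatMixed.lang_eq_iff_exists_bisimulation h₁ h₂,
    fun _ _ hν hβ => KatMixed.exists_computable_decision hν hβ⟩
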